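/- A planar convex body is a compact convex set $K\subset\mathbb{R}^2$ with nonempty interior. Its covariogram is the function $g_K(x)=\lambda_2\bigl(K\cap(K+x)\bigr)$, $x\in\mathbb{R}^2$, where $\lambda_2$ is the Lebesgue measure. The body $K$ is strictly convex if for any two distinct points of $K$ the open segment between them lies in the interior of $K$, and it is $C^1$-regular if at every point $p$ of its boundary $\operatorname{bd}K$ there is precisely one line supporting $K$ at $p$. A non-degenerate boundary arc of $K$ is a set $A\subset\operatorname{bd}K$ of the form $A=q([0,1])$ with $q:[0,1]\to\mathbb{R}^2$ continuous and injective. Let $K$ and $L$ be planar convex bodies that are strictly convex and $C^1$-regular, and suppose that $g_K(x)=g_L(x)$ for all $x\in\mathbb{R}^2$. Then there is a non-degenerate boundary arc $A$ of $L$ such that some translate $A+v$ $(v\in\mathbb{R}^2)$ of $A$, or the reflection $2c-A$ of $A$ in some point $c\in\mathbb{R}^2$, is contained in $\operatorname{bd}K$. -/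

import Mathlib

open MeasureTheory
open scoped Pointwise

/-- The covariogram `g_C(x) = V(C ∩ (C + x))` of a set `C` in Euclidean space, where `V` is
Lebesgue measure. It is meant for compact `C`, for which the volume is finite. -/
noncomputable def covariogram {d : ℕ} (C : Set (EuclideanSpace ℝ (Fin d))) :
    EuclideanSpace ℝ (Fin d) → ℝ :=
  fun x => volume.real (C ∩ (x +ᵥ C))

/-- `H` is a hyperplane supporting `K` at the point `p`: it is the hyperplane through `p` with some
normal `u ≠ 0`, and `K` lies in the half-space bounded by `H` of which `u` is an outward normal. -/
def IsSupportingHyperplaneAt {d : ℕ} (K : Set (EuclideanSpace ℝ (Fin d)))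
    (p : EuclideanSpace ℝ (Fin d)) (H : Set (EuclideanSpace ℝ (Fin d))) : Prop :=
  ∃ u : EuclideanSpace ℝ (Fin d), u ≠ 0 ∧ H = {x | inner ℝ u x = inner ℝ u p} ∧
    ∀ y ∈ K, inner ℝ u y ≤ inner ℝ u p

/-- `K` is `C¹` regular: at every boundary point there is precisely one supporting hyperplane. -/
def IsC1Regular {d : ℕ} (K : Set (EuclideanSpace ℝ (Fin d))) : Prop :=
  ∀ p ∈ frontier K, ∃! H : Set (EuclideanSpace ℝ (Fin d)), IsSupportingHyperplaneAt K p H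

/-- `A` is a non-degenerate boundary arc of `K`: a subset of the boundary of `K` that is the image
of an injective continuous path on `[0, 1]`. Injectivity makes the two endpoints distinct. -/
def IsNondegenerateBoundaryArc {d : ℕ} (K A : Set (EuclideanSpace ℝ (Fin d))) : Prop :=
  A ⊆ frontier K ∧
    ∃ q : unitInterval → EuclideanSpace ℝ (Fin d),
      Continuous q ∧ Function.Injective q ∧ Set.range q = A

/-!
# Planar ovals with the same covariogram share a boundary arc

Call a strictly convex planar body with unique unit normals an oval. For an inner vector `x` of an
oval `K` there is exactly one parallelogram inscribed in `K` with edge `x`; its vertices are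
`edgeFoot K x`, `edgeFoot K x + x`, `edgeFoot K (-x)`, `edgeFoot K (-x) - x`, and they are
differentiable functions of `x` (`IsOval.hasStrictFDerivAt_edgeFoot`). Their derivatives are given
by the directions of the tangents at the vertices.

*The covariogram determines the inscribed parallelograms up to translation*
(`edgeFoot_neg_sub_eq`). The derivative of the covariogram along the ray of `x` gives the width of
the parallelogram orthogonal to `x`. So the difference `E` between the second edges for `K` and
for `L` is parallel to `x`. The derivative of a second edge has a trace that does not depend on
the oval, so the derivative of `E` has trace zero. A vector field that is radial and divergence
free on the star-shaped set of inner vectors and bounded near its centre `0` vanishes. The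
derivatives of `E` vanish too: the sum of `edgeFootDeriv` at `x` and `-x` is the same for `K` and
`L`.

*Rigidity* (`edgeFootDeriv_eq_or_eq`). Call a chord diametral if it joins the support points of
two opposite directions; the diametral chords of `K` and `L` are translates of each other. If a
diagonal of the parallelogram is diametral, the sum just mentioned determines the unordered pair
of tangent directions at the two other vertices: were the pairs different, a motion of the
parallelogram that keeps one vertex in `L` fixed would turn the tangents of `K` at the diametral
vertices in the wrong way.

*Sweeping an arc* (`exists_supportPoint_sub_or_add_const`). If moreover the two other tangents are
not parallel, the parallelogram moves in a family of parallelograms with diametral diagonals, by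
the inverse function theorem. By rigidity the derivatives of the diametral vertices, as functions
of the edge, agree in `K` and `L` along the family, up to the exchange of `x` and `-x`. So the
vertices of `K` are those of `L` up to a fixed translation or point reflection. They sweep
boundary arcs.

*The remaining case* (`IsOval.diametralSum_eq_of_forall`). Suppose that neither body has such a
transversal parallelogram with a diametral diagonal. Then for each diametral chord with midpoint
`c`, the boundary of the body never crosses its reflection in `c`. An extremum argument for the
function `u ↦ ⟪u, diametralSum K u - diametralSum K n⟫` shows that all diametral chords have the
same midpoint. As the diametral chords of `K` and `L` agree up to translations, `K` is a translate
of `L`.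
-/

open Set Filter Topology
open scoped RealInnerProductSpace

/-! ### The quarter turn of the Euclidean plane -/

/-- The Euclidean plane. -/
abbrev Plane := EuclideanSpace ℝ (Fin 2)

/-- The rotation of the plane by a right angle; `⟪quarterTurn u, v⟫` is the determinant of
`(u, v)`. -/
noncomputable def quarterTurn : Plane →L[ℝ] Plane :=
  LinearMap.toContinuousLinearMap
    { toFun := fun v => !₂[-v 1, v 0]
      map_add' := fun u v => by
        ext i; fin_cases i <;> simp [add_comm]
      map_smul' := fun c v => by
        ext i; fin_cases i <;> simp }

namespace Plane

lemma quarterTurn_apply_zero (v : Plane) : quarterTurn v 0 = -v 1 := by simp [quarterTurn]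

lemma quarterTurn_apply_one (v : Plane) : quarterTurn v 1 = v 0 := by simp [quarterTurn]

lemma inner_eq (u v : Plane) : ⟪u, v⟫ = u 0 * v 0 + u 1 * v 1 := by
  simp [PiLp.inner_apply, Fin.sum_univ_two, mul_comm]

@[simp] lemma quarterTurn_quarterTurn (v : Plane) : quarterTurn (quarterTurn v) = -v := by
  ext i; fin_cases i <;> simp [quarterTurn]

@[simp] lemma inner_quarterTurn_self (v : Plane) : ⟪quarterTurn v, v⟫ = 0 := by
  rw [inner_eq, quarterTurn_apply_zero, quarterTurn_apply_one]; ring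

@[simp] lemma inner_self_quarterTurn (v : Plane) : ⟪v, quarterTurn v⟫ = 0 := by
  rw [real_inner_comm]; simp

lemma inner_quarterTurn_comm (u v : Plane) : ⟪quarterTurn u, v⟫ = -⟪quarterTurn v, u⟫ := by
  simp only [inner_eq, quarterTurn_apply_zero, quarterTurn_apply_one]; ring

lemma inner_quarterTurn_quarterTurn (u v : Plane) :
    ⟪quarterTurn u, quarterTurn v⟫ = ⟪u, v⟫ := by
  simp only [inner_eq, quarterTurn_apply_zero, quarterTurn_apply_one]; ring

@[simp] lemma norm_quarterTurn (v : Plane) : ‖quarterTurn v‖ = ‖v‖ := by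
  rw [← sq_eq_sq₀ (norm_nonneg _) (norm_nonneg _), ← real_inner_self_eq_norm_sq,
    ← real_inner_self_eq_norm_sq, inner_quarterTurn_quarterTurn]

lemma quarterTurn_ne_zero {v : Plane} (hv : v ≠ 0) : quarterTurn v ≠ 0 := by
  rw [← norm_ne_zero_iff, norm_quarterTurn]; exact norm_ne_zero_iff.2 hv

/-- The expansion of a vector in the orthogonal frame `(n, quarterTurn n)`. -/
lemma norm_sq_smul_eq (n v : Plane) :
    ‖n‖ ^ 2 • v = ⟪n, v⟫ • n + ⟪quarterTurn n, v⟫ • quarterTurn n := by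
  have h : ‖n‖ ^ 2 = n 0 * n 0 + n 1 * n 1 := by
    rw [← real_inner_self_eq_norm_sq, inner_eq]
  rw [h]
  ext i
  fin_cases i <;>
  · simp [inner_eq, quarterTurn_apply_zero, quarterTurn_apply_one]
    ring

lemma eq_inner_smul_add {n : Plane} (hn : ‖n‖ = 1) (v : Plane) :
    v = ⟪n, v⟫ • n + ⟪quarterTurn n, v⟫ • quarterTurn n := by
  simpa [hn] using norm_sq_smul_eq n v

lemma inner_eq_frame {n : Plane} (hn : ‖n‖ = 1) (u v : Plane) :
    ⟪u, v⟫ = ⟪n, u⟫ * ⟪n, v⟫ + ⟪quarterTurn n, u⟫ * ⟪quarterTurn n, v⟫ := by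
  conv_lhs => rw [eq_inner_smul_add hn v]
  rw [inner_add_right, inner_smul_right, inner_smul_right, real_inner_comm n u,
    real_inner_comm (quarterTurn n) u]
  ring

lemma eq_zero_of_inner {n v : Plane} (hn : n ≠ 0) (h : ⟪n, v⟫ = 0)
    (h' : ⟪quarterTurn n, v⟫ = 0) : v = 0 := by
  have := norm_sq_smul_eq n v
  rw [h, h'] at this
  simpa [hn] using this

/-- Linearly dependent unit vectors of the plane agree up to sign. -/
lemma eq_or_eq_neg_of_inner_quarterTurn_eq_zero {m n : Plane} (hm : ‖m‖ = 1) (hn : ‖n‖ = 1)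
    (h : ⟪quarterTurn m, n⟫ = 0) : n = m ∨ n = -m := by
  have h1 := eq_inner_smul_add hm n
  rw [h, zero_smul, add_zero] at h1
  have h2 : |⟪m, n⟫| = 1 := by
    have := congrArg norm h1
    rw [norm_smul, hm, hn, mul_one] at this
    simpa using this.symm
  rcases eq_or_eq_neg_of_abs_eq h2 with h3 | h3
  · left; rw [h1, h3, one_smul]
  · right; rw [h1, h3, neg_one_smul]

end Plane

open Plane

/-! ### Support points and normals of a smooth strictly convex body -/

/-- `u` is an outward normal direction of `K` at `p`, possibly zero. -/
def IsOuterNormal (K : Set Plane) (p u : Plane) : Prop := ∀ y ∈ K, ⟪u, y⟫ ≤ ⟪u, p⟫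

/-- A strictly convex planar body with exactly one outward unit normal at each boundary point. -/
structure IsOval (K : Set Plane) : Prop where
  isCompact : IsCompact K
  strictConvex : StrictConvex ℝ K
  nonempty_interior : (interior K).Nonempty
  normal_unique : ∀ p ∈ frontier K, ∀ u v : Plane, ‖u‖ = 1 → ‖v‖ = 1 →
    IsOuterNormal K p u → IsOuterNormal K p v → u = v

lemma IsOuterNormal.inner_lt_of_mem_interior {K : Set Plane} {p u z : Plane}
    (h : IsOuterNormal K p u) (hu : u ≠ 0) (hz : z ∈ interior K) : ⟪u, z⟫ < ⟪u, p⟫ := by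
  have hc : Tendsto (fun t : ℝ => z + t • u) (𝓝[>] 0) (𝓝 z) := by
    have : Continuous (fun t : ℝ => z + t • u) := by fun_prop
    simpa using (this.tendsto 0).mono_left nhdsWithin_le_nhds
  obtain ⟨t, ht, ht0⟩ := ((hc.eventually (mem_interior_iff_mem_nhds.1 hz)).and
    self_mem_nhdsWithin).exists
  have h1 := h _ ht
  rw [inner_add_right, inner_smul_right] at h1
  have : 0 < t * ⟪u, u⟫ := mul_pos ht0 (real_inner_self_pos.2 hu)
  linarith

lemma IsOuterNormal.smul {K : Set Plane} {p u : Plane} (h : IsOuterNormal K p u) {c : ℝ}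
    (hc : 0 ≤ c) : IsOuterNormal K p (c • u) := fun y hy => by
  rw [inner_smul_left, inner_smul_left]
  exact mul_le_mul_of_nonneg_left (h y hy) hc

/-- Tendsto along a filter, from compactness and uniqueness of the limits along ultrafilters. -/
lemma tendsto_of_isCompact_of_ultrafilter {X Y : Type*} [TopologicalSpace Y] {l : Filter X}
    {s : Set Y} (hs : IsCompact s) {f : X → Y} {y : Y} (hf : ∀ᶠ x in l, f x ∈ s)
    (h : ∀ U : Ultrafilter X, ↑U ≤ l → ∀ y' ∈ s, Tendsto f U (𝓝 y') → y' = y) :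
    Tendsto f l (𝓝 y) := by
  refine hs.tendsto_nhds_of_unique_mapClusterPt hf fun y' hy' hc => ?_
  obtain ⟨U, hU, hUf⟩ := mapClusterPt_iff_ultrafilter.1 hc
  exact h U hU y' hy' hUf

open Classical in
/-- A point of `K` at which `u` is an outward normal. -/
noncomputable def supportPoint (K : Set Plane) (u : Plane) : Plane :=
  if h : ∃ p ∈ K, IsOuterNormal K p u then h.choose else 0

open Classical in
/-- An outward unit normal of `K` at `p`. -/
noncomputable def unitNormal (K : Set Plane) (p : Plane) : Plane :=
  if h : ∃ u, ‖u‖ = 1 ∧ IsOuterNormal K p u then h.choose else 0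

namespace IsOval

variable {K : Set Plane} (hK : IsOval K)
include hK

lemma convex : Convex ℝ K := hK.strictConvex.convex

lemma isClosed : IsClosed K := hK.isCompact.isClosed

lemma nonempty : K.Nonempty := hK.nonempty_interior.mono interior_subset

lemma frontier_subset : frontier K ⊆ K := hK.isClosed.frontier_subset

lemma closure_interior : closure (interior K) = K := by
  rw [hK.convex.closure_interior_eq_closure_of_nonempty_interior hK.nonempty_interior,
    hK.isClosed.closure_eq]

lemma midpoint_mem_interior {p q : Plane} (hp : p ∈ K) (hq : q ∈ K) (h : p ≠ q) :
    (1 / 2 : ℝ) • p + (1 / 2 : ℝ) • q ∈ interior K :=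
  hK.strictConvex hp hq h (by norm_num) (by norm_num) (by norm_num)

lemma mem_frontier_of_isOuterNormal {p u : Plane} (hp : p ∈ K) (hu : u ≠ 0)
    (h : IsOuterNormal K p u) : p ∈ frontier K := by
  rw [hK.isClosed.frontier_eq]
  exact ⟨hp, fun hi => lt_irrefl _ (h.inner_lt_of_mem_interior hu hi)⟩

lemma inner_lt {p u y : Plane} (hp : p ∈ K) (hu : u ≠ 0) (h : IsOuterNormal K p u) (hy : y ∈ K)
    (hyp : y ≠ p) : ⟪u, y⟫ < ⟪u, p⟫ := by
  have := h.inner_lt_of_mem_interior hu (hK.midpoint_mem_interior hy hp hyp)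
  rw [inner_add_right, inner_smul_right, inner_smul_right] at this
  linarith

lemma exists_isOuterNormal {p : Plane} (hp : p ∈ frontier K) :
    ∃ u, ‖u‖ = 1 ∧ IsOuterNormal K p u := by
  have hpi : p ∉ interior K := by
    rw [hK.isClosed.frontier_eq] at hp; exact hp.2
  obtain ⟨f, hf⟩ := geometric_hahn_banach_open_point hK.convex.interior isOpen_interior hpi
  set u : Plane := (InnerProductSpace.toDual ℝ Plane).symm f with hu
  have hfu : ∀ y, ⟪u, y⟫ = f y := fun y => InnerProductSpace.toDual_symm_apply
  have hn : IsOuterNormal K p u := by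
    intro y hy
    rw [← hK.closure_interior] at hy
    have hcl : IsClosed {y : Plane | ⟪u, y⟫ ≤ ⟪u, p⟫} :=
      isClosed_le (by fun_prop) (by fun_prop)
    refine closure_minimal (fun z hz => ?_) hcl hy
    simp only [mem_ofPred_eq, hfu]
    exact (hf z hz).le
  have hu0 : u ≠ 0 := by
    obtain ⟨z, hz⟩ := hK.nonempty_interior
    intro h0
    have := hf z hz
    rw [← hfu, ← hfu, h0] at this
    simp at this
  refine ⟨‖u‖⁻¹ • u, norm_smul_inv_norm hu0, hn.smul (by positivity)⟩

lemma exists_supportPoint (u : Plane) : ∃ p ∈ K, IsOuterNormal K p u := by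
  obtain ⟨p, hp, hmax⟩ := hK.isCompact.exists_isMaxOn hK.nonempty
    (f := fun y => ⟪u, y⟫) (by fun_prop)
  exact ⟨p, hp, fun y hy => hmax hy⟩

lemma supportPoint_mem (u : Plane) : supportPoint K u ∈ K := by
  rw [supportPoint, dif_pos (hK.exists_supportPoint u)]
  exact (hK.exists_supportPoint u).choose_spec.1

lemma isOuterNormal_supportPoint (u : Plane) : IsOuterNormal K (supportPoint K u) u := by
  rw [supportPoint, dif_pos (hK.exists_supportPoint u)]
  exact (hK.exists_supportPoint u).choose_spec.2

lemma inner_le_supportPoint (u : Plane) {y : Plane} (hy : y ∈ K) :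
    ⟪u, y⟫ ≤ ⟪u, supportPoint K u⟫ := hK.isOuterNormal_supportPoint u y hy

lemma eq_supportPoint {p u : Plane} (hp : p ∈ K) (hu : u ≠ 0) (h : IsOuterNormal K p u) :
    p = supportPoint K u := by
  by_contra hne
  have := hK.inner_lt hp hu h (hK.supportPoint_mem u) (Ne.symm hne)
  exact absurd (hK.inner_le_supportPoint u hp) (not_le.2 this)

lemma supportPoint_mem_frontier {u : Plane} (hu : u ≠ 0) : supportPoint K u ∈ frontier K :=
  hK.mem_frontier_of_isOuterNormal (hK.supportPoint_mem u) hu (hK.isOuterNormal_supportPoint u)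

lemma norm_unitNormal {p : Plane} (hp : p ∈ frontier K) : ‖unitNormal K p‖ = 1 := by
  rw [unitNormal, dif_pos (hK.exists_isOuterNormal hp)]
  exact (hK.exists_isOuterNormal hp).choose_spec.1

lemma unitNormal_ne_zero {p : Plane} (hp : p ∈ frontier K) : unitNormal K p ≠ 0 := by
  rw [← norm_ne_zero_iff, hK.norm_unitNormal hp]; exact one_ne_zero

lemma isOuterNormal_unitNormal {p : Plane} (hp : p ∈ frontier K) :
    IsOuterNormal K p (unitNormal K p) := by
  rw [unitNormal, dif_pos (hK.exists_isOuterNormal hp)]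
  exact (hK.exists_isOuterNormal hp).choose_spec.2

lemma eq_unitNormal {p u : Plane} (hp : p ∈ frontier K) (hu : ‖u‖ = 1)
    (h : IsOuterNormal K p u) : u = unitNormal K p :=
  hK.normal_unique p hp u _ hu (hK.norm_unitNormal hp) h (hK.isOuterNormal_unitNormal hp)

lemma supportPoint_unitNormal {p : Plane} (hp : p ∈ frontier K) :
    supportPoint K (unitNormal K p) = p :=
  (hK.eq_supportPoint (hK.frontier_subset hp) (hK.unitNormal_ne_zero hp)
    (hK.isOuterNormal_unitNormal hp)).symm

lemma unitNormal_supportPoint {u : Plane} (hu : u ≠ 0) :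
    unitNormal K (supportPoint K u) = ‖u‖⁻¹ • u :=
  (hK.eq_unitNormal (hK.supportPoint_mem_frontier hu) (norm_smul_inv_norm hu)
    ((hK.isOuterNormal_supportPoint u).smul (by positivity))).symm

lemma inner_unitNormal_lt {p y : Plane} (hp : p ∈ frontier K) (hy : y ∈ K) (hyp : y ≠ p) :
    ⟪unitNormal K p, y⟫ < ⟪unitNormal K p, p⟫ :=
  hK.inner_lt (hK.frontier_subset hp) (hK.unitNormal_ne_zero hp)
    (hK.isOuterNormal_unitNormal hp) hy hyp

lemma supportPoint_ne_neg {u : Plane} (hu : u ≠ 0) :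
    supportPoint K u ≠ supportPoint K (-u) := by
  intro h
  obtain ⟨z, hz⟩ := hK.nonempty_interior
  have h1 := (hK.isOuterNormal_supportPoint u).inner_lt_of_mem_interior hu hz
  have h2 := (hK.isOuterNormal_supportPoint (-u)).inner_lt_of_mem_interior (neg_ne_zero.2 hu) hz
  rw [← h, inner_neg_left, inner_neg_left] at h2
  linarith

lemma continuousAt_supportPoint {u : Plane} (hu : u ≠ 0) :
    ContinuousAt (supportPoint K) u := by
  refine tendsto_of_isCompact_of_ultrafilter hK.isCompact
    (Eventually.of_forall hK.supportPoint_mem) fun U hU p hp hUp => ?_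
  refine hK.eq_supportPoint hp hu fun y hy => ?_
  have hUu : Tendsto (fun v : Plane => v) U (𝓝 u) := hU
  exact le_of_tendsto_of_tendsto' (hUu.inner tendsto_const_nhds) (hUu.inner hUp)
    fun v => hK.inner_le_supportPoint v hy

lemma continuousOn_unitNormal : ContinuousOn (unitNormal K) (frontier K) := by
  intro p hp
  refine tendsto_of_isCompact_of_ultrafilter (isCompact_sphere (0 : Plane) 1)
    (eventually_mem_nhdsWithin.mono fun q hq => by simpa using hK.norm_unitNormal hq)
    fun U hU u hu hUu => ?_
  refine hK.eq_unitNormal hp (by simpa using hu) fun y hy => ?_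
  have hUp : Tendsto (fun v : Plane => v) U (𝓝 p) := hU.trans nhdsWithin_le_nhds
  have hUf : ∀ᶠ q in (U : Filter Plane), q ∈ frontier K := hU self_mem_nhdsWithin
  exact le_of_tendsto_of_tendsto (hUu.inner tendsto_const_nhds) (hUu.inner hUp)
    (hUf.mono fun q hq => hK.isOuterNormal_unitNormal hq y hy)

/-- The boundary of a smooth convex body is strictly differentiable: chords with both ends close
to `p` are almost orthogonal to the normal at `p`. -/
lemma eventually_abs_inner_unitNormal_le {p : Plane} (hp : p ∈ frontier K) {ε : ℝ} (hε : 0 < ε) :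
    ∀ᶠ q : Plane × Plane in 𝓝 (p, p), q.1 ∈ frontier K → q.2 ∈ frontier K →
      |⟪unitNormal K p, q.1 - q.2⟫| ≤ ε * ‖q.1 - q.2‖ := by
  have hev : ∀ᶠ q in 𝓝 p, q ∈ frontier K → ‖unitNormal K q - unitNormal K p‖ < ε := by
    have := (hK.continuousOn_unitNormal p hp).eventually (Metric.ball_mem_nhds _ hε)
    rw [eventually_nhdsWithin_iff] at this
    simpa [dist_eq_norm] using this
  have key : ∀ q r, q ∈ frontier K → r ∈ frontier K → ‖unitNormal K q - unitNormal K p‖ < ε →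
      -(ε * ‖q - r‖) ≤ ⟪unitNormal K p, q - r⟫ := by
    intro q r hq hr hn
    have h1 := hK.isOuterNormal_unitNormal hq r (hK.frontier_subset hr)
    have h2 := abs_real_inner_le_norm (unitNormal K q - unitNormal K p) (q - r)
    have h3 := (abs_le.1 h2).2
    rw [inner_sub_left, inner_sub_right (unitNormal K q)] at h3
    have := mul_le_mul_of_nonneg_right hn.le (norm_nonneg (q - r))
    linarith
  rw [nhds_prod_eq]
  filter_upwards [hev.prod_mk hev]
  rintro ⟨q, r⟩ ⟨hq, hr⟩ hqf hrf
  refine abs_le.2 ⟨key q r hqf hrf (hq hqf), ?_⟩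
  have := key r q hrf hqf (hr hrf)
  dsimp only
  rw [norm_sub_rev, ← neg_sub q r, inner_neg_right] at this
  linarith

end IsOval

/-! ### Inscribed parallelograms with a prescribed edge -/

/-- The set of the points `z` of `K` for which `z + x` is in `K`: up to a translation this is the
intersection of `K` with `K + x`. -/
def chordFeet (K : Set Plane) (x : Plane) : Set Plane := {z | z ∈ K ∧ z + x ∈ K}

/-- `x` is a nonzero vector for which the interiors of `K` and `K + x` meet. -/
def IsInnerVector (K : Set Plane) (x : Plane) : Prop :=
  x ≠ 0 ∧ ∃ z, z ∈ interior K ∧ z + x ∈ interior K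

open Classical in
/-- The point of `chordFeet K x` where the functional `⟪quarterTurn x, ·⟫` is minimal. The
parallelogram inscribed in `K` with edge `x` has the vertices `edgeFoot K x`, `edgeFoot K x + x`,
`edgeFoot K (-x)` and `edgeFoot K (-x) - x`, in cyclic order. -/
noncomputable def edgeFoot (K : Set Plane) (x : Plane) : Plane :=
  if h : ∃ z ∈ chordFeet K x, ∀ y ∈ chordFeet K x, ⟪quarterTurn x, z⟫ ≤ ⟪quarterTurn x, y⟫
  then h.choose else 0

lemma IsInnerVector.neg {K : Set Plane} {x : Plane} (hx : IsInnerVector K x) :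
    IsInnerVector K (-x) := by
  obtain ⟨h0, z, hz, hzx⟩ := hx
  exact ⟨neg_ne_zero.2 h0, z + x, hzx, by simpa using hz⟩

lemma isOpen_setOf_isInnerVector (K : Set Plane) : IsOpen {x | IsInnerVector K x} := by
  rw [isOpen_iff_mem_nhds]
  rintro x ⟨h0, z, hz, hzx⟩
  have hc : Tendsto (fun y => z + y) (𝓝 x) (𝓝 (z + x)) := by
    have : Continuous (fun y : Plane => z + y) := by fun_prop
    exact this.tendsto x
  filter_upwards [hc.eventually (isOpen_interior.mem_nhds hzx), isOpen_ne.mem_nhds h0]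
    with y hy hy0 using ⟨hy0, z, hz, hy⟩

lemma IsInnerVector.eventually {K : Set Plane} {x : Plane} (hx : IsInnerVector K x) :
    ∀ᶠ y in 𝓝 x, IsInnerVector K y := (isOpen_setOf_isInnerVector K).mem_nhds hx

lemma exists_smul_mem_of_mem_interior {K : Set Plane} {p q : Plane} (hp : p ∈ interior K) :
    ∃ t : ℝ, 0 < t ∧ t ≤ 1 ∧ p + t • q ∈ K := by
  have h1 : Tendsto (fun t : ℝ => p + t • q) (𝓝[>] 0) (𝓝 p) := by
    have : Continuous (fun t : ℝ => p + t • q) := by fun_prop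
    simpa using (this.tendsto 0).mono_left nhdsWithin_le_nhds
  obtain ⟨t, ht, ht0, ht1⟩ := ((h1.eventually (mem_interior_iff_mem_nhds.1 hp)).and
    (Ioc_mem_nhdsGT one_pos)).exists
  exact ⟨t, ht0, ht1, ht⟩

namespace IsOval

variable {K : Set Plane} (hK : IsOval K)
include hK

lemma isInnerVector_smul {x : Plane} (hx : IsInnerVector K x) {s : ℝ} (hs : 0 < s) (hs1 : s ≤ 1) :
    IsInnerVector K (s • x) := by
  obtain ⟨h0, z, hz, hzx⟩ := hx
  refine ⟨smul_ne_zero hs.ne' h0, z, hz, ?_⟩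
  have := hK.convex.interior hz hzx (sub_nonneg.2 hs1) hs.le (by ring)
  convert this using 1
  module

lemma isClosed_chordFeet (x : Plane) : IsClosed (chordFeet K x) :=
  hK.isClosed.inter (hK.isClosed.preimage (f := fun z => z + x) (by fun_prop))

lemma isCompact_chordFeet (x : Plane) : IsCompact (chordFeet K x) :=
  hK.isCompact.of_isClosed_subset (hK.isClosed_chordFeet x) fun _ h => h.1

lemma edgeFoot_spec {x : Plane} (hx : IsInnerVector K x) : edgeFoot K x ∈ chordFeet K x ∧
    ∀ y ∈ chordFeet K x, ⟪quarterTurn x, edgeFoot K x⟫ ≤ ⟪quarterTurn x, y⟫ := by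
  have h : ∃ z ∈ chordFeet K x, ∀ y ∈ chordFeet K x,
      ⟪quarterTurn x, z⟫ ≤ ⟪quarterTurn x, y⟫ := by
    obtain ⟨-, z, hz, hzx⟩ := hx
    obtain ⟨p, hp, hmin⟩ := (hK.isCompact_chordFeet x).exists_isMinOn
      ⟨z, interior_subset hz, interior_subset hzx⟩ (f := fun y => ⟪quarterTurn x, y⟫)
      (by fun_prop)
    exact ⟨p, hp, fun y hy => hmin hy⟩
  rw [edgeFoot, dif_pos h]
  exact h.choose_spec

lemma edgeFoot_mem {x : Plane} (hx : IsInnerVector K x) : edgeFoot K x ∈ K :=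
  (hK.edgeFoot_spec hx).1.1

lemma edgeFoot_add_mem {x : Plane} (hx : IsInnerVector K x) : edgeFoot K x + x ∈ K :=
  (hK.edgeFoot_spec hx).1.2

/-- Points with both `w` and `w + x` interior to `K` lie strictly above the minimum. -/
lemma inner_edgeFoot_lt {x w : Plane} (hx : IsInnerVector K x) (hw : w ∈ interior K)
    (hwx : w + x ∈ interior K) : ⟪quarterTurn x, edgeFoot K x⟫ < ⟪quarterTurn x, w⟫ := by
  have hJ := quarterTurn_ne_zero hx.1
  have h1 : Tendsto (fun t : ℝ => w - t • quarterTurn x) (𝓝[>] 0) (𝓝 w) := by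
    have : Continuous (fun t : ℝ => w - t • quarterTurn x) := by fun_prop
    simpa using (this.tendsto 0).mono_left nhdsWithin_le_nhds
  have h2 : Tendsto (fun t : ℝ => w - t • quarterTurn x + x) (𝓝[>] 0) (𝓝 (w + x)) :=
    h1.add_const x
  obtain ⟨t, ⟨ht1, ht2⟩, ht0⟩ := (((h1.eventually (mem_interior_iff_mem_nhds.1 hw)).and
    (h2.eventually (mem_interior_iff_mem_nhds.1 hwx))).and self_mem_nhdsWithin).exists
  have h3 := (hK.edgeFoot_spec hx).2 _ ⟨ht1, ht2⟩
  rw [inner_sub_right, inner_smul_right] at h3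
  have : 0 < t * ⟪quarterTurn x, quarterTurn x⟫ := mul_pos ht0 (real_inner_self_pos.2 hJ)
  linarith

lemma eq_edgeFoot {x z : Plane} (hx : IsInnerVector K x) (hz : z ∈ chordFeet K x)
    (h : ⟪quarterTurn x, z⟫ ≤ ⟪quarterTurn x, edgeFoot K x⟫) : z = edgeFoot K x := by
  by_contra hne
  have h1 := hK.midpoint_mem_interior hz.1 (hK.edgeFoot_mem hx) hne
  have h2 := hK.midpoint_mem_interior hz.2 (hK.edgeFoot_add_mem hx) (by simpa using hne)
  have h3 : (1 / 2 : ℝ) • (z + x) + (1 / 2 : ℝ) • (edgeFoot K x + x) =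
      (1 / 2 : ℝ) • z + (1 / 2 : ℝ) • edgeFoot K x + x := by module
  rw [h3] at h2
  have := hK.inner_edgeFoot_lt hx h1 h2
  rw [inner_add_right, inner_smul_right, inner_smul_right] at this
  linarith

lemma exists_mem_inner_lt {p v : Plane} (hp : p ∈ interior K) (hv : v ≠ 0) :
    ∃ q ∈ K, ⟪v, q⟫ < ⟪v, p⟫ := by
  refine ⟨supportPoint K (-v), hK.supportPoint_mem _, ?_⟩
  have := (hK.isOuterNormal_supportPoint (-v)).inner_lt_of_mem_interior (neg_ne_zero.2 hv) hp
  rw [inner_neg_left, inner_neg_left] at this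
  linarith

lemma edgeFoot_mem_frontier {x : Plane} (hx : IsInnerVector K x) : edgeFoot K x ∈ frontier K := by
  rw [hK.isClosed.frontier_eq]
  refine ⟨hK.edgeFoot_mem hx, fun hi => ?_⟩
  obtain ⟨q, hq, hlt⟩ := hK.exists_mem_inner_lt hi (quarterTurn_ne_zero hx.1)
  -- Sliding the far end of the chord towards `q` inside `K` lowers the functional.
  obtain ⟨t, ht0, ht1, ht⟩ := exists_smul_mem_of_mem_interior (q := q - (edgeFoot K x + x)) hi
  have h1 : edgeFoot K x + t • (q - (edgeFoot K x + x)) + x ∈ K := by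
    have := hK.convex (hK.edgeFoot_add_mem hx) hq (sub_nonneg.2 ht1) ht0.le (by ring)
    convert this using 1
    module
  have h2 := (hK.edgeFoot_spec hx).2 _ ⟨ht, h1⟩
  rw [inner_add_right, inner_smul_right, inner_sub_right, inner_add_right,
    inner_quarterTurn_self] at h2
  nlinarith

lemma edgeFoot_add_mem_frontier {x : Plane} (hx : IsInnerVector K x) :
    edgeFoot K x + x ∈ frontier K := by
  rw [hK.isClosed.frontier_eq]
  refine ⟨hK.edgeFoot_add_mem hx, fun hi => ?_⟩
  obtain ⟨q, hq, hlt⟩ := hK.exists_mem_inner_lt hi (quarterTurn_ne_zero hx.1)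
  obtain ⟨t, ht0, ht1, ht⟩ := exists_smul_mem_of_mem_interior (q := q - edgeFoot K x) hi
  have h1 : edgeFoot K x + t • (q - edgeFoot K x) ∈ K := by
    have := hK.convex (hK.edgeFoot_mem hx) hq (sub_nonneg.2 ht1) ht0.le (by ring)
    convert this using 1
    module
  have h2 := (hK.edgeFoot_spec hx).2 _ ⟨h1, by convert ht using 1; abel⟩
  rw [inner_add_right, inner_smul_right, inner_sub_right] at h2
  rw [inner_add_right, inner_quarterTurn_self] at hlt
  nlinarith

lemma edgeFoot_neg_sub_mem_frontier {x : Plane} (hx : IsInnerVector K x) :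
    edgeFoot K (-x) - x ∈ frontier K := by
  simpa [sub_eq_add_neg] using hK.edgeFoot_add_mem_frontier hx.neg

/-- The functional `⟪quarterTurn x, ·⟫` separates the two inscribed chords equal to `x`. -/
lemma inner_edgeFoot_lt_neg {x : Plane} (hx : IsInnerVector K x) :
    ⟪quarterTurn x, edgeFoot K x⟫ < ⟪quarterTurn x, edgeFoot K (-x)⟫ := by
  obtain ⟨-, z, hz, hzx⟩ := id hx
  have h1 := hK.inner_edgeFoot_lt hx hz hzx
  have h2 := hK.inner_edgeFoot_lt hx.neg hzx (by simpa using hz)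
  rw [map_neg, inner_neg_left, inner_neg_left, inner_add_right, inner_quarterTurn_self] at h2
  linarith

/-- Only two chords of `K` are translates of the segment from `0` to `x`. -/
lemma eq_edgeFoot_or_eq {x z : Plane} (hx : IsInnerVector K x) (hz : z ∈ frontier K)
    (hzx : z + x ∈ frontier K) : z = edgeFoot K x ∨ z = edgeFoot K (-x) - x := by
  by_contra! hne
  have hzK := hK.frontier_subset hz
  have hzxK := hK.frontier_subset hzx
  have ha := hK.edgeFoot_mem hx
  have hax := hK.edgeFoot_add_mem hx
  have hb := hK.frontier_subset (hK.edgeFoot_neg_sub_mem_frontier hx)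
  have hbx := hK.edgeFoot_mem hx.neg
  have hlt := hK.inner_edgeFoot_lt_neg hx
  have h1 : ⟪quarterTurn x, edgeFoot K x⟫ < ⟪quarterTurn x, z⟫ := by
    by_contra! h
    exact hne.1 (hK.eq_edgeFoot hx ⟨hzK, hzxK⟩ h)
  have h2 : ⟪quarterTurn x, z⟫ < ⟪quarterTurn x, edgeFoot K (-x)⟫ := by
    by_contra! h
    refine hne.2 (eq_sub_of_add_eq (hK.eq_edgeFoot hx.neg ⟨hzxK, by simpa using hzK⟩ ?_))
    rw [map_neg, inner_neg_left, inner_neg_left, inner_add_right, inner_quarterTurn_self]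
    linarith
  set a := edgeFoot K x with ha_def
  set b := edgeFoot K (-x) - x with hb_def
  have hbx' : b + x ∈ K := by simpa [hb_def] using hbx
  have h2' : ⟪quarterTurn x, z⟫ < ⟪quarterTurn x, b⟫ := by
    rw [hb_def, inner_sub_right, inner_quarterTurn_self]; linarith
  -- The line through `z` parallel to `x` meets the segment from `a` to `b` in `w`.
  set l := (⟪quarterTurn x, z⟫ - ⟪quarterTurn x, a⟫) /
    (⟪quarterTurn x, b⟫ - ⟪quarterTurn x, a⟫) with hl
  have hd : 0 < ⟪quarterTurn x, b⟫ - ⟪quarterTurn x, a⟫ := by linarith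
  have hl0 : 0 < l := div_pos (by linarith) hd
  have hl1 : l < 1 := by rw [hl, div_lt_one hd]; linarith
  set w := (1 - l) • a + l • b with hw
  have hab : a ≠ b := by rintro h; rw [h] at hd; simp at hd
  have hwi : w ∈ interior K :=
    hK.strictConvex ha hb hab (by linarith) hl0 (by ring)
  have hwxi : w + x ∈ interior K := by
    have := hK.strictConvex hax hbx' (by simpa using hab) (sub_pos.2 hl1) hl0 (by ring)
    convert this using 1
    rw [hw]; module
  have hJ : ⟪quarterTurn x, z - w⟫ = 0 := by
    have : l * (⟪quarterTurn x, b⟫ - ⟪quarterTurn x, a⟫) =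
      ⟪quarterTurn x, z⟫ - ⟪quarterTurn x, a⟫ := div_mul_cancel₀ _ hd.ne'
    rw [hw, inner_sub_right, inner_add_right, inner_smul_right, inner_smul_right]
    linarith
  have hx0 : 0 < ‖x‖ ^ 2 := by have := hx.1; positivity
  obtain ⟨s, hs⟩ : ∃ s : ℝ, z = w + s • x := by
    refine ⟨⟪x, z - w⟫ / ‖x‖ ^ 2, ?_⟩
    have := norm_sq_smul_eq x (z - w)
    rw [hJ, zero_smul, add_zero] at this
    rw [div_eq_inv_mul, mul_smul, ← this, smul_smul, inv_mul_cancel₀ hx0.ne', one_smul]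
    abel
  rw [hK.isClosed.frontier_eq] at hz hzx
  rcases le_or_gt 0 s with h0 | h0
  · refine hz.2 ?_
    have h := hK.convex.combo_interior_self_mem_interior hwi hzxK (a := 1 / (1 + s))
      (b := s / (1 + s)) (by positivity) (by positivity) (by field_simp)
    convert h using 1
    rw [hs]
    match_scalars <;> field_simp
    ring
  · refine hzx.2 ?_
    have h := hK.convex.combo_interior_self_mem_interior hwxi hzK (a := 1 / (1 - s))
      (b := -s / (1 - s)) (by apply div_pos <;> linarith)
      (by apply div_nonneg <;> linarith) (by rw [← add_div]; apply div_self; linarith)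
    convert h using 1
    rw [hs]
    have : 1 - s ≠ 0 := by linarith
    match_scalars <;> field_simp <;> ring

/-- The normals at the two ends of an inscribed chord with interior vector are independent. -/
lemma inner_unitNormal_ne_zero {x : Plane} (hx : IsInnerVector K x) :
    ⟪unitNormal K (edgeFoot K x + x), quarterTurn (unitNormal K (edgeFoot K x))⟫ ≠ 0 := by
  intro h
  have hp := hK.edgeFoot_mem_frontier hx
  have hq := hK.edgeFoot_add_mem_frontier hx
  rw [real_inner_comm] at h
  rcases eq_or_eq_neg_of_inner_quarterTurn_eq_zero (hK.norm_unitNormal hp)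
    (hK.norm_unitNormal hq) h with h1 | h1
  · have h2 := hK.supportPoint_unitNormal hp
    rw [← h1, hK.supportPoint_unitNormal hq] at h2
    exact hx.1 (by simpa using h2)
  · obtain ⟨-, z, hz, hzx⟩ := id hx
    have h2 := (hK.isOuterNormal_unitNormal hp).inner_lt_of_mem_interior
      (hK.unitNormal_ne_zero hp) hz
    have h3 := (hK.isOuterNormal_unitNormal hq).inner_lt_of_mem_interior
      (hK.unitNormal_ne_zero hq) hzx
    rw [h1, inner_neg_left, inner_neg_left, inner_add_right, inner_add_right] at h3
    linarith

lemma continuousAt_edgeFoot {x : Plane} (hx : IsInnerVector K x) :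
    ContinuousAt (edgeFoot K) x := by
  refine tendsto_of_isCompact_of_ultrafilter hK.isCompact
    (hx.eventually.mono fun y hy => hK.edgeFoot_mem hy) fun U hU p hp hUp => ?_
  have hUx : Tendsto (fun v : Plane => v) U (𝓝 x) := hU
  have hUi : ∀ᶠ y in (U : Filter Plane), IsInnerVector K y := hU hx.eventually
  have hpx : p + x ∈ K := hK.isClosed.mem_of_tendsto (hUp.add hUx)
    (hUi.mono fun y hy => hK.edgeFoot_add_mem hy)
  refine hK.eq_edgeFoot hx ⟨hp, hpx⟩ ?_
  have hUJ : Tendsto (fun v : Plane => quarterTurn v) U (𝓝 (quarterTurn x)) :=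
    (quarterTurn.continuous.tendsto x).comp hUx
  have key : ∀ z, z ∈ interior K → z + x ∈ interior K →
      ⟪quarterTurn x, p⟫ ≤ ⟪quarterTurn x, z⟫ := by
    intro z hz hzx
    have hc : Tendsto (fun y => z + y) U (𝓝 (z + x)) := hUx.const_add z
    refine le_of_tendsto_of_tendsto (hUJ.inner hUp) (hUJ.inner tendsto_const_nhds) ?_
    filter_upwards [hc.eventually (mem_interior_iff_mem_nhds.1 hzx), hUi] with y hy hyi
    exact (hK.edgeFoot_spec hyi).2 z ⟨interior_subset hz, hy⟩
  obtain ⟨-, z, hz, hzx⟩ := id hx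
  have hseg : ∀ t ∈ Ioo (0 : ℝ) 1, ⟪quarterTurn x, p⟫ ≤
      (1 - t) * ⟪quarterTurn x, edgeFoot K x⟫ + t * ⟪quarterTurn x, z⟫ := by
    intro t ht
    have h1 := hK.convex.combo_self_interior_mem_interior (hK.edgeFoot_mem hx) hz
      (sub_nonneg.2 ht.2.le) ht.1 (by ring)
    have h2 := hK.convex.combo_self_interior_mem_interior (hK.edgeFoot_add_mem hx) hzx
      (sub_nonneg.2 ht.2.le) ht.1 (by ring)
    have := key _ h1 (by convert h2 using 1; module)
    rwa [inner_add_right, inner_smul_right, inner_smul_right] at this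
  have hlim : Tendsto (fun t : ℝ => (1 - t) * ⟪quarterTurn x, edgeFoot K x⟫ +
      t * ⟪quarterTurn x, z⟫) (𝓝[>] 0) (𝓝 ⟪quarterTurn x, edgeFoot K x⟫) := by
    have : Continuous (fun t : ℝ => (1 - t) * ⟪quarterTurn x, edgeFoot K x⟫ +
      t * ⟪quarterTurn x, z⟫) := by fun_prop
    simpa using (this.tendsto 0).mono_left nhdsWithin_le_nhds
  exact ge_of_tendsto hlim (mem_of_superset (Ioo_mem_nhdsGT one_pos) hseg)

end IsOval

/-! ### The derivative of the vertices of the inscribed parallelogram -/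

/-- For `n`, `m` linearly independent, minus the projection onto the line orthogonal to `n` along
the line orthogonal to `m`. It is the derivative of the foot of a chord whose ends have the
normals `n` and `m`, as a function of the chord vector. -/
noncomputable def footSlide (n m : Plane) : Plane →L[ℝ] Plane :=
  (-⟪m, quarterTurn n⟫⁻¹) • (innerSL ℝ m).smulRight (quarterTurn n)

lemma footSlide_apply (n m v : Plane) :
    footSlide n m v = (-(⟪m, v⟫ / ⟪m, quarterTurn n⟫)) • quarterTurn n := by
  simp [footSlide, smul_smul, div_eq_inv_mul]

lemma inner_footSlide (n m v : Plane) : ⟪n, footSlide n m v⟫ = 0 := by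
  rw [footSlide_apply, inner_smul_right]; simp

lemma inner_footSlide_add {n m : Plane} (h : ⟪m, quarterTurn n⟫ ≠ 0) (v : Plane) :
    ⟪m, footSlide n m v + v⟫ = 0 := by
  rw [footSlide_apply, inner_add_right, inner_smul_right, neg_mul, div_mul_cancel₀ _ h,
    neg_add_cancel]

lemma continuousAt_footSlide {X : Type*} [TopologicalSpace X] {f g : X → Plane} {x : X}
    (hf : ContinuousAt f x) (hg : ContinuousAt g x) (h : ⟪g x, quarterTurn (f x)⟫ ≠ 0) :
    ContinuousAt (fun y => footSlide (f y) (g y)) x := by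
  have h1 : ContinuousAt (fun y => quarterTurn (f y)) x :=
    quarterTurn.continuous.continuousAt.comp hf
  have h2 : ContinuousAt (fun y => innerSL ℝ (g y)) x :=
    (innerSL ℝ : Plane →L⋆[ℝ] Plane →L[ℝ] ℝ).continuous.continuousAt.comp hg
  refine ((hg.inner h1).inv₀ h).neg.smul ?_
  exact ((ContinuousLinearMap.smulRightL ℝ Plane Plane).continuous.continuousAt.comp h2).clm_apply
    h1

lemma norm_le_of_inner_le {n m : Plane} (hn : ‖n‖ = 1) (hm : ‖m‖ = 1)
    (h : ⟪m, quarterTurn n⟫ ≠ 0) (r : Plane) :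
    ‖r‖ ≤ (1 + |⟪m, quarterTurn n⟫|⁻¹) * (|⟪n, r⟫| + |⟪m, r⟫|) := by
  have hd : 0 < |⟪m, quarterTurn n⟫| := abs_pos.2 h
  have h1 := inner_eq_frame hn m r
  have h2 : |⟪n, m⟫| ≤ 1 := by simpa [hn, hm] using abs_real_inner_le_norm n m
  have h3 : |⟪quarterTurn n, r⟫| ≤ |⟪m, quarterTurn n⟫|⁻¹ * (|⟪n, r⟫| + |⟪m, r⟫|) := by
    rw [inv_mul_eq_div, le_div_iff₀ hd, ← abs_mul]
    have : ⟪quarterTurn n, r⟫ * ⟪m, quarterTurn n⟫ = ⟪m, r⟫ - ⟪n, m⟫ * ⟪n, r⟫ := by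
      rw [h1, real_inner_comm m (quarterTurn n)]; ring
    rw [this]
    refine (abs_sub _ _).trans ?_
    rw [abs_mul]
    nlinarith [abs_nonneg ⟪n, r⟫]
  have h4 : ‖r‖ ≤ |⟪n, r⟫| + |⟪quarterTurn n, r⟫| := by
    conv_lhs => rw [eq_inner_smul_add hn r]
    refine (norm_add_le _ _).trans ?_
    simp [norm_smul, hn]
  have := abs_nonneg ⟪m, r⟫
  linarith

namespace IsOval

variable {K : Set Plane} (hK : IsOval K)
include hK

lemma continuousAt_unitNormal_comp {X : Type*} [TopologicalSpace X] {f : X → Plane} {x : X}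
    (hf : ContinuousAt f x) (hm : ∀ᶠ y in 𝓝 x, f y ∈ frontier K) :
    ContinuousAt (fun y => unitNormal K (f y)) x := by
  have h := hK.continuousOn_unitNormal (f x) hm.self_of_nhds
  exact h.tendsto.comp (tendsto_nhdsWithin_iff.2 ⟨hf, hm⟩)

lemma continuousAt_unitNormal_edgeFoot {x : Plane} (hx : IsInnerVector K x) :
    ContinuousAt (fun y => unitNormal K (edgeFoot K y)) x :=
  hK.continuousAt_unitNormal_comp (hK.continuousAt_edgeFoot hx)
    (hx.eventually.mono fun _ hy => hK.edgeFoot_mem_frontier hy)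

lemma continuousAt_unitNormal_edgeFoot_add {x : Plane} (hx : IsInnerVector K x) :
    ContinuousAt (fun y => unitNormal K (edgeFoot K y + y)) x :=
  hK.continuousAt_unitNormal_comp ((hK.continuousAt_edgeFoot hx).add continuousAt_id)
    (hx.eventually.mono fun _ hy => hK.edgeFoot_add_mem_frontier hy)

end IsOval

/-- The derivative of `edgeFoot K` at `x`. -/
noncomputable def edgeFootDeriv (K : Set Plane) (x : Plane) : Plane →L[ℝ] Plane :=
  footSlide (unitNormal K (edgeFoot K x)) (unitNormal K (edgeFoot K x + x))

namespace IsOval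

variable {K : Set Plane} (hK : IsOval K)
include hK

lemma continuousAt_edgeFootDeriv {x : Plane} (hx : IsInnerVector K x) :
    ContinuousAt (edgeFootDeriv K) x :=
  continuousAt_footSlide (hK.continuousAt_unitNormal_edgeFoot hx)
    (hK.continuousAt_unitNormal_edgeFoot_add hx) (hK.inner_unitNormal_ne_zero hx)

/-- Both ends of the chord move along the boundary, so up to first order their velocities are
orthogonal to independent normals; this determines the velocities. -/
lemma hasStrictFDerivAt_edgeFoot {x : Plane} (hx : IsInnerVector K x) :
    HasStrictFDerivAt (edgeFoot K) (edgeFootDeriv K x) x := by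
  set n := unitNormal K (edgeFoot K x) with hn
  set m := unitNormal K (edgeFoot K x + x) with hm
  have hp := hK.edgeFoot_mem_frontier hx
  have hq := hK.edgeFoot_add_mem_frontier hx
  have hδ : ⟪m, quarterTurn n⟫ ≠ 0 := hK.inner_unitNormal_ne_zero hx
  have hA : edgeFootDeriv K x = footSlide n m := rfl
  set A := edgeFootDeriv K x
  set C := 1 + |⟪m, quarterTurn n⟫|⁻¹ with hC
  have hC0 : 0 < C := by positivity
  rw [hasStrictFDerivAt_iff_isLittleO, Asymptotics.isLittleO_iff]
  intro c hc
  set a := ‖A‖ with ha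
  have ha0 : 0 ≤ a := norm_nonneg _
  obtain ⟨ε, hε, hε1, hε2⟩ : ∃ ε : ℝ, 0 < ε ∧ C * ε ≤ 1 / 4 ∧ C * ε * (2 * (2 * a + 1)) ≤ c := by
    refine ⟨min (1 / (4 * C)) (c / (C * (2 * (2 * a + 1)))), by positivity, ?_, ?_⟩
    · calc C * _ ≤ C * (1 / (4 * C)) := by gcongr; exact min_le_left _ _
        _ = 1 / 4 := by field_simp
    · calc C * _ * (2 * (2 * a + 1)) ≤ C * (c / (C * (2 * (2 * a + 1)))) * (2 * (2 * a + 1)) := by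
            gcongr; exact min_le_right _ _
        _ = c := by field_simp
  have hc1 := hK.continuousAt_edgeFoot hx
  have hc2 : ContinuousAt (fun y => edgeFoot K y + y) x := hc1.add continuousAt_id
  have t1 : Tendsto (fun q : Plane × Plane => (edgeFoot K q.1, edgeFoot K q.2)) (𝓝 (x, x))
      (𝓝 (edgeFoot K x, edgeFoot K x)) := by
    rw [nhds_prod_eq, nhds_prod_eq]; exact hc1.tendsto.prodMap hc1.tendsto
  have t2 : Tendsto (fun q : Plane × Plane => (edgeFoot K q.1 + q.1, edgeFoot K q.2 + q.2))
      (𝓝 (x, x)) (𝓝 (edgeFoot K x + x, edgeFoot K x + x)) := by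
    rw [nhds_prod_eq, nhds_prod_eq]; exact hc2.tendsto.prodMap hc2.tendsto
  have hin : ∀ᶠ q : Plane × Plane in 𝓝 (x, x), IsInnerVector K q.1 ∧ IsInnerVector K q.2 := by
    rw [nhds_prod_eq]; exact hx.eventually.prod_mk hx.eventually
  filter_upwards [t1.eventually (hK.eventually_abs_inner_unitNormal_le hp hε),
    t2.eventually (hK.eventually_abs_inner_unitNormal_le hq hε), hin]
  rintro ⟨y, z⟩ h1 h2 ⟨hy, hz⟩
  dsimp only at h1 h2 hy hz ⊢
  replace h1 := h1 (hK.edgeFoot_mem_frontier hy) (hK.edgeFoot_mem_frontier hz)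
  replace h2 := h2 (hK.edgeFoot_add_mem_frontier hy) (hK.edgeFoot_add_mem_frontier hz)
  rw [← hn] at h1
  rw [← hm, show edgeFoot K y + y - (edgeFoot K z + z) =
    (edgeFoot K y - edgeFoot K z) + (y - z) by abel] at h2
  set w := edgeFoot K y - edgeFoot K z
  set v := y - z
  have hr := norm_le_of_inner_le (hK.norm_unitNormal hp) (hK.norm_unitNormal hq) hδ (w - A v)
  rw [← hn, ← hm, ← hC] at hr
  have h3 : ⟪n, w - A v⟫ = ⟪n, w⟫ := by
    rw [inner_sub_right, hA, inner_footSlide, sub_zero]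
  have h4 : ⟪m, w - A v⟫ = ⟪m, w + v⟫ := by
    have := inner_footSlide_add hδ v
    rw [← hA, inner_add_right] at this
    rw [inner_sub_right, inner_add_right]
    linarith
  rw [h3, h4] at hr
  have h5 : ‖w‖ ≤ ‖w - A v‖ + a * ‖v‖ := by
    calc ‖w‖ = ‖(w - A v) + A v‖ := by rw [sub_add_cancel]
      _ ≤ _ := (norm_add_le _ _).trans (by gcongr; exact A.le_opNorm v)
  have h6 : ‖w + v‖ ≤ ‖w‖ + ‖v‖ := norm_add_le _ _
  have h7 : ‖w - A v‖ ≤ C * ε * (2 * ‖w - A v‖ + (2 * a + 1) * ‖v‖) := by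
    calc ‖w - A v‖ ≤ C * (ε * ‖w‖ + ε * ‖w + v‖) := hr.trans (by gcongr)
      _ = C * ε * (‖w‖ + ‖w + v‖) := by ring
      _ ≤ _ := mul_le_mul_of_nonneg_left (by linarith) (by positivity)
  have h8 : C * ε * (2 * ‖w - A v‖) ≤ 1 / 4 * (2 * ‖w - A v‖) := by gcongr
  have h9 : C * ε * (2 * (2 * a + 1)) * ‖v‖ ≤ c * ‖v‖ := by gcongr
  linarith

end IsOval

/-! ### The covariogram determines the widths of the inscribed parallelograms -/

/-- The linear coordinates of the plane with axes along `quarterTurn x` and `x`. -/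
noncomputable def axisMap (x : Plane) : ℝ × ℝ →L[ℝ] Plane :=
  (ContinuousLinearMap.fst ℝ ℝ ℝ).smulRight (quarterTurn x) +
    (ContinuousLinearMap.snd ℝ ℝ ℝ).smulRight x

lemma axisMap_apply (x : Plane) (p : ℝ × ℝ) : axisMap x p = p.1 • quarterTurn x + p.2 • x := by
  simp [axisMap]

lemma inner_quarterTurn_axisMap (x : Plane) (p : ℝ × ℝ) :
    ⟪quarterTurn x, axisMap x p⟫ = p.1 * ‖x‖ ^ 2 := by
  rw [axisMap_apply, inner_add_right, inner_smul_right, inner_smul_right,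
    real_inner_self_eq_norm_sq, norm_quarterTurn, inner_quarterTurn_self]
  ring

lemma inner_axisMap (x : Plane) (p : ℝ × ℝ) : ⟪x, axisMap x p⟫ = p.2 * ‖x‖ ^ 2 := by
  rw [axisMap_apply, inner_add_right, inner_smul_right, inner_smul_right,
    real_inner_self_eq_norm_sq, inner_self_quarterTurn]
  ring

lemma axisMap_injective {x : Plane} (hx : x ≠ 0) : Function.Injective (axisMap x) := by
  intro p q h
  have hn : ‖x‖ ^ 2 ≠ 0 := by positivity
  have h1 := congrArg (fun v => ⟪quarterTurn x, v⟫) h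
  have h2 := congrArg (fun v => ⟪x, v⟫) h
  simp only [inner_quarterTurn_axisMap, inner_axisMap] at h1 h2
  exact Prod.ext (mul_right_cancel₀ hn h1) (mul_right_cancel₀ hn h2)

lemma axisMap_surjective {x : Plane} (hx : x ≠ 0) : Function.Surjective (axisMap x) := by
  intro v
  have hn : ‖x‖ ^ 2 ≠ 0 := by positivity
  refine ⟨(⟪quarterTurn x, v⟫ / ‖x‖ ^ 2, ⟪x, v⟫ / ‖x‖ ^ 2), ?_⟩
  have := norm_sq_smul_eq x v
  rw [axisMap_apply]
  apply smul_right_injective _ hn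
  simp only
  rw [this, smul_add, smul_smul, smul_smul, mul_div_cancel₀ _ hn, mul_div_cancel₀ _ hn, add_comm]

/-- In the coordinates given by `axisMap x`, Lebesgue measure is scaled by a constant. -/
lemma exists_volume_preimage_axisMap {x : Plane} (hx : x ≠ 0) :
    ∃ c : ENNReal, ∀ s : Set Plane, volume (axisMap x ⁻¹' s) = c * volume s := by
  set e : (ℝ × ℝ) ≃L[ℝ] Plane := (LinearEquiv.ofBijective (axisMap x : ℝ × ℝ →ₗ[ℝ] Plane)
    ⟨axisMap_injective hx, axisMap_surjective hx⟩).toContinuousLinearEquiv with he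
  have hμ : (Measure.map e volume).IsAddHaarMeasure := e.isAddHaarMeasure_map volume
  refine ⟨(Measure.map e volume).addHaarScalarFactor volume, fun s => ?_⟩
  have h1 := Measure.isAddLeftInvariant_eq_smul (Measure.map e volume) volume
  have h2 : Measure.map e volume s = volume (e ⁻¹' s) :=
    e.toHomeomorph.toMeasurableEquiv.map_apply s
  have h3 : (axisMap x ⁻¹' s) = e ⁻¹' s := rfl
  rw [h3, ← h2]
  conv_lhs => rw [h1]
  rfl

/-- The width, in the coordinates of `axisMap x`, of the parallelogram inscribed in `K` with edge
`s • x`. -/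
noncomputable def edgeWidth (K : Set Plane) (x : Plane) (s : ℝ) : ℝ :=
  ⟪quarterTurn x, edgeFoot K (-(s • x)) - edgeFoot K (s • x)⟫ / ‖x‖ ^ 2

namespace IsOval

variable {K : Set Plane} (hK : IsOval K)
include hK

/-- In the coordinates of `axisMap x`, the set `chordFeet K (s • x)` meets the line at height `r` in
the chord of `K` at that height, shortened by `s`. The value of `ℓ` is the length of the chord, or
negative if the line misses `K`. -/
lemma exists_volume_section {x : Plane} (hx : x ≠ 0) (r : ℝ) : ∃ ℓ : ℝ, ∀ s : ℝ, 0 ≤ s →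
    volume {t : ℝ | axisMap x (r, t) ∈ chordFeet K (s • x)} = ENNReal.ofReal (ℓ - s) ∧
    ({t : ℝ | axisMap x (r, t) ∈ chordFeet K (s • x)}.Nonempty ↔ s ≤ ℓ) := by
  set I := {t : ℝ | axisMap x (r, t) ∈ K} with hI
  have hshift : ∀ s t : ℝ, axisMap x (r, t) + s • x = axisMap x (r, t + s) := by
    intro s t; simp only [axisMap_apply]; module
  have hsec : ∀ s : ℝ, {t : ℝ | axisMap x (r, t) ∈ chordFeet K (s • x)} =
      {t | t ∈ I ∧ t + s ∈ I} := by
    intro s; ext t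
    simp only [chordFeet, mem_ofPred_eq, hshift, hI]
  have hcont : Continuous fun t : ℝ => axisMap x (r, t) := by fun_prop
  have hIcl : IsClosed I := hK.isClosed.preimage hcont
  have hIord : I.OrdConnected := by
    have : Convex ℝ I := by
      intro t ht u hu a b ha hb hab
      have h := hK.convex ht hu ha hb hab
      obtain rfl : b = 1 - a := by linarith
      have h1 : axisMap x (r, a • t + (1 - a) • u) ∈ K := by
        convert h using 1
        simp only [axisMap_apply, smul_eq_mul]
        module
      exact h1
    exact this.ordConnected
  have hIb : Bornology.IsBounded I := by
    obtain ⟨R, hR⟩ := hK.isCompact.isBounded.exists_norm_le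
    refine (Metric.isBounded_iff_subset_closedBall 0).2 ⟨R * ‖x‖ / ‖x‖ ^ 2, fun t ht => ?_⟩
    have h1 := hR _ ht
    have h2 := abs_real_inner_le_norm x (axisMap x (r, t))
    have hn : 0 < ‖x‖ ^ 2 := by positivity
    rw [inner_axisMap, abs_mul, abs_of_pos hn] at h2
    rw [mem_closedBall_zero_iff, Real.norm_eq_abs, le_div_iff₀ hn]
    refine h2.trans ?_
    rw [mul_comm]
    gcongr
  have hIc : IsCompact I := Metric.isCompact_of_isClosed_isBounded hIcl hIb
  obtain ⟨k, l, hkl⟩ : ∃ k l, I = Icc k l := by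
    rcases I.eq_empty_or_nonempty with he | hne
    · exact ⟨1, 0, by rw [he, Icc_eq_empty (by norm_num)]⟩
    · exact ⟨sInf I, sSup I, Subset.antisymm (subset_Icc_csInf_csSup hIc.bddBelow hIc.bddAbove)
        (hIord.out (hIc.sInf_mem hne) (hIc.sSup_mem hne))⟩
  refine ⟨l - k, fun s hs => ?_⟩
  have h1 : {t | t ∈ I ∧ t + s ∈ I} = Icc k (l - s) := by
    ext t
    rw [mem_ofPred_eq, hkl]
    constructor
    · rintro ⟨⟨h1, h2⟩, h3, h4⟩; exact ⟨h1, by linarith⟩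
    · rintro ⟨h1, h2⟩; exact ⟨⟨h1, by linarith⟩, by linarith, by linarith⟩
  rw [hsec, h1, Real.volume_Icc, nonempty_Icc]
  refine ⟨by congr 1; ring, ?_⟩
  constructor <;> intro h <;> linarith

/-- The heights of the chords of `K` at least as long as `s • x` range between the heights of the
two chords equal to `s • x`. -/
lemma setOf_nonempty_section_eq_Icc {x : Plane} {s : ℝ} (hs : 0 < s)
    (hsx : IsInnerVector K (s • x)) :
    {r : ℝ | {t : ℝ | axisMap x (r, t) ∈ chordFeet K (s • x)}.Nonempty} =
      Icc (⟪quarterTurn x, edgeFoot K (s • x)⟫ / ‖x‖ ^ 2)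
        (⟪quarterTurn x, edgeFoot K (-(s • x))⟫ / ‖x‖ ^ 2) := by
  have hx : x ≠ 0 := fun h => hsx.1 (by rw [h, smul_zero])
  have hn : 0 < ‖x‖ ^ 2 := by positivity
  have hconv : Convex ℝ (chordFeet K (s • x)) := by
    intro y hy z hz a b ha hb hab
    refine ⟨hK.convex hy.1 hz.1 ha hb hab, ?_⟩
    have := hK.convex hy.2 hz.2 ha hb hab
    convert this using 1
    have h1 : s • x = (a + b) • s • x := by rw [hab, one_smul]
    conv_lhs => rw [h1]
    module
  have h1 : ∀ z, ⟪quarterTurn (s • x), z⟫ = s * ⟪quarterTurn x, z⟫ := by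
    intro z; rw [map_smul, real_inner_smul_left]
  have hx0 : ⟪quarterTurn x, s • x⟫ = 0 := by rw [inner_smul_right]; simp
  have ha := hK.edgeFoot_spec hsx
  have hb := hK.edgeFoot_spec hsx.neg
  ext r
  rw [mem_ofPred_eq, mem_Icc, div_le_iff₀ hn, le_div_iff₀ hn]
  constructor
  · rintro ⟨t, ht⟩
    rw [← inner_quarterTurn_axisMap x (r, t)]
    constructor
    · have := ha.2 _ ht
      rw [h1, h1] at this
      exact le_of_mul_le_mul_left this hs
    · have := hb.2 (axisMap x (r, t) + s • x) ⟨ht.2, by simpa using ht.1⟩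
      rw [map_neg, inner_neg_left, inner_neg_left, h1, h1, inner_add_right, hx0, add_zero] at this
      exact le_of_mul_le_mul_left (neg_le_neg_iff.1 this) hs
  · rintro ⟨hr1, hr2⟩
    have hb' : edgeFoot K (-(s • x)) - s • x ∈ chordFeet K (s • x) :=
      ⟨by simpa [sub_eq_add_neg] using hb.1.2, by simpa using hb.1.1⟩
    have himg : Convex ℝ ((innerSL ℝ (quarterTurn x)) '' chordFeet K (s • x)) :=
      hconv.linear_image (innerSL ℝ (quarterTurn x)).toLinearMap
    have := himg.ordConnected.out ⟨_, ha.1, rfl⟩ ⟨_, hb', rfl⟩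
    obtain ⟨z, hz, hzr⟩ := @this (r * ‖x‖ ^ 2) (by
      simp only [innerSL_apply_apply, inner_sub_right, hx0, sub_zero]
      exact ⟨hr1, hr2⟩)
    obtain ⟨⟨r', t⟩, rfl⟩ := axisMap_surjective hx z
    rw [innerSL_apply_apply, inner_quarterTurn_axisMap] at hzr
    have := mul_right_cancel₀ hn.ne' hzr
    dsimp only at this
    subst this
    exact ⟨t, hz⟩

lemma measurableSet_preimage_axisMap (x y : Plane) :
    MeasurableSet (axisMap x ⁻¹' chordFeet K y) :=
  ((hK.isClosed_chordFeet y).preimage (axisMap x).continuous).measurableSet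

lemma volume_preimage_chordFeet (x y : Plane) : volume (axisMap x ⁻¹' chordFeet K y) =
    ∫⁻ r, volume {t : ℝ | axisMap x (r, t) ∈ chordFeet K y} := by
  rw [Measure.volume_eq_prod, Measure.prod_apply (hK.measurableSet_preimage_axisMap x y)]
  rfl

lemma volume_chordFeet (x : Plane) :
    volume (chordFeet K x) = ENNReal.ofReal (covariogram K x) := by
  have h1 : K ∩ (x +ᵥ K) = x +ᵥ chordFeet K x := by
    ext z
    rw [mem_inter_iff, mem_vadd_set_iff_neg_vadd_mem, mem_vadd_set_iff_neg_vadd_mem, chordFeet,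
      mem_ofPred_eq]
    simp [and_comm]
  have h2 : volume (K ∩ (x +ᵥ K)) ≠ ⊤ :=
    ne_top_of_le_ne_top hK.isCompact.measure_lt_top.ne (measure_mono inter_subset_left)
  rw [covariogram, Measure.real, ENNReal.ofReal_toReal h2, h1, measure_vadd]

lemma volume_nonempty_section {x : Plane} {s : ℝ} (hs : 0 < s) (hsx : IsInnerVector K (s • x)) :
    volume {r : ℝ | {t : ℝ | axisMap x (r, t) ∈ chordFeet K (s • x)}.Nonempty} =
      ENNReal.ofReal (edgeWidth K x s) := by
  rw [hK.setOf_nonempty_section_eq_Icc hs hsx, Real.volume_Icc, edgeWidth, inner_sub_right, sub_div]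

lemma volume_preimage_add_le {x : Plane} (hx : x ≠ 0) {s s' : ℝ} (hs : 0 < s) (hss : s < s')
    (hsx : IsInnerVector K (s' • x)) :
    volume (axisMap x ⁻¹' chordFeet K (s' • x)) +
        ENNReal.ofReal (s' - s) * ENNReal.ofReal (edgeWidth K x s') ≤
      volume (axisMap x ⁻¹' chordFeet K (s • x)) := by
  classical
  have hs' := hs.trans hss
  rw [← hK.volume_nonempty_section hs' hsx, hK.volume_preimage_chordFeet,
    hK.volume_preimage_chordFeet]
  have hm : MeasurableSet
      {r : ℝ | {t : ℝ | axisMap x (r, t) ∈ chordFeet K (s' • x)}.Nonempty} := by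
    rw [hK.setOf_nonempty_section_eq_Icc hs' hsx]; exact measurableSet_Icc
  rw [← lintegral_indicator_const hm, ← lintegral_add_right _ (measurable_const.indicator hm)]
  refine lintegral_mono fun r => ?_
  obtain ⟨ℓ, hℓ⟩ := hK.exists_volume_section hx r
  dsimp only
  rw [(hℓ s hs.le).1, (hℓ s' hs'.le).1, indicator_apply]
  have hiff : r ∈ {r : ℝ | {t : ℝ | axisMap x (r, t) ∈ chordFeet K (s' • x)}.Nonempty} ↔ s' ≤ ℓ :=
    (hℓ s' hs'.le).2
  split_ifs with h <;> rw [hiff] at h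
  · rw [← ENNReal.ofReal_add (by linarith) (by linarith)]
    exact ENNReal.ofReal_le_ofReal (by linarith)
  · rw [add_zero]
    exact ENNReal.ofReal_le_ofReal (by linarith)

lemma volume_preimage_le_add {x : Plane} (hx : x ≠ 0) {s s' : ℝ} (hs : 0 < s) (hss : s < s')
    (hsx : IsInnerVector K (s • x)) :
    volume (axisMap x ⁻¹' chordFeet K (s • x)) ≤
      volume (axisMap x ⁻¹' chordFeet K (s' • x)) +
        ENNReal.ofReal (s' - s) * ENNReal.ofReal (edgeWidth K x s) := by
  classical
  have hs' := hs.trans hss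
  rw [← hK.volume_nonempty_section hs hsx, hK.volume_preimage_chordFeet,
    hK.volume_preimage_chordFeet]
  have hm : MeasurableSet
      {r : ℝ | {t : ℝ | axisMap x (r, t) ∈ chordFeet K (s • x)}.Nonempty} := by
    rw [hK.setOf_nonempty_section_eq_Icc hs hsx]; exact measurableSet_Icc
  rw [← lintegral_indicator_const hm, ← lintegral_add_right _ (measurable_const.indicator hm)]
  refine lintegral_mono fun r => ?_
  obtain ⟨ℓ, hℓ⟩ := hK.exists_volume_section hx r
  dsimp only
  rw [(hℓ s hs.le).1, (hℓ s' hs'.le).1, indicator_apply]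
  have hiff : r ∈ {r : ℝ | {t : ℝ | axisMap x (r, t) ∈ chordFeet K (s • x)}.Nonempty} ↔ s ≤ ℓ :=
    (hℓ s hs.le).2
  split_ifs with h <;> rw [hiff] at h
  · refine le_trans ?_ ENNReal.ofReal_add_le
    exact ENNReal.ofReal_le_ofReal (by linarith)
  · rw [ENNReal.ofReal_of_nonpos (by linarith)]
    exact zero_le

lemma isInnerVector_iff_covariogram_pos {x : Plane} (hx : x ≠ 0) :
    IsInnerVector K x ↔ 0 < covariogram K x := by
  have h := hK.volume_chordFeet x
  have h1 : chordFeet K x = K ∩ (fun z => z + x) ⁻¹' K := rfl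
  have h2 : interior (chordFeet K x) = {z | z ∈ interior K ∧ z + x ∈ interior K} := by
    rw [h1, interior_inter]
    have := (Homeomorph.addRight x).preimage_interior K
    simp only [Homeomorph.coe_addRight] at this
    rw [← this]
    rfl
  have hconv : Convex ℝ (chordFeet K x) :=
    hK.convex.inter (hK.convex.translate_preimage_left x)
  constructor
  · rintro ⟨-, z, hz⟩
    rw [← ENNReal.ofReal_pos, ← h]
    have : (interior (chordFeet K x)).Nonempty := by rw [h2]; exact ⟨z, hz⟩
    exact (isOpen_interior.measure_pos volume this).trans_le (measure_mono interior_subset)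
  · intro hpos
    rw [← ENNReal.ofReal_pos, ← h] at hpos
    refine ⟨hx, ?_⟩
    have : (interior (chordFeet K x)).Nonempty := by
      by_contra hne
      rw [not_nonempty_iff_eq_empty] at hne
      have h3 := hconv.addHaar_frontier volume
      rw [(hK.isClosed_chordFeet x).frontier_eq, hne, sdiff_empty] at h3
      exact hpos.ne' h3
    rw [h2] at this
    exact this

end IsOval

section Comparison

variable {K L : Set Plane} (hK : IsOval K) (hL : IsOval L) (hg : covariogram K = covariogram L)
include hK hL hg

lemma isInnerVector_congr {x : Plane} : IsInnerVector K x ↔ IsInnerVector L x := by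
  by_cases hx : x = 0
  · exact ⟨fun h => absurd hx h.1, fun h => absurd hx h.1⟩
  · rw [hK.isInnerVector_iff_covariogram_pos hx, hL.isInnerVector_iff_covariogram_pos hx, hg]

/-- The inequality is obtained by comparing the difference quotients of the covariogram along the
ray of `x` with the widths at both ends of the increment. -/
lemma edgeWidth_le {x : Plane} (hx : IsInnerVector K x) :
    edgeWidth L x 1 ≤ edgeWidth K x 1 := by
  have hxL := (isInnerVector_congr hK hL hg).1 hx
  have hcs : Tendsto (fun s : ℝ => s • x) (𝓝[>] 1) (𝓝 x) := by
    have : Continuous (fun s : ℝ => s • x) := by fun_prop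
    simpa using (this.tendsto 1).mono_left nhdsWithin_le_nhds
  have hlim : Tendsto (fun s : ℝ => edgeWidth L x s) (𝓝[>] 1) (𝓝 (edgeWidth L x 1)) := by
    simp only [edgeWidth, one_smul]
    refine (tendsto_const_nhds.inner (Tendsto.sub ?_ ?_)).div_const _
    · exact (hL.continuousAt_edgeFoot hxL.neg).tendsto.comp hcs.neg
    · exact (hL.continuousAt_edgeFoot hxL).tendsto.comp hcs
  refine le_of_tendsto hlim ?_
  filter_upwards [self_mem_nhdsWithin, hcs.eventually hxL.eventually] with s hs hsx
  have hs : 1 < s := hs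
  obtain ⟨c, hc⟩ := exists_volume_preimage_axisMap hx.1
  have heq : ∀ y, volume (axisMap x ⁻¹' chordFeet K y) = volume (axisMap x ⁻¹' chordFeet L y) := by
    intro y
    rw [hc, hc, hK.volume_chordFeet, hL.volume_chordFeet, hg]
  have h1 := hL.volume_preimage_add_le hx.1 one_pos hs hsx
  have h2 := hK.volume_preimage_le_add hx.1 one_pos hs (by rwa [one_smul])
  rw [heq, heq] at h2
  have hfin : volume (axisMap x ⁻¹' chordFeet L (s • x)) ≠ ⊤ := by
    have hcl : IsCompact (axisMap x ⁻¹' chordFeet L (s • x)) := by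
      have : Topology.IsClosedEmbedding (axisMap x) :=
        LinearMap.isClosedEmbedding_of_injective (f := (axisMap x).toLinearMap)
          (LinearMap.ker_eq_bot.2 (axisMap_injective hx.1))
      exact this.isCompact_preimage (hL.isCompact_chordFeet _)
    exact hcl.measure_lt_top.ne
  have h3 := (ENNReal.add_le_add_iff_left hfin).1 (h1.trans h2)
  have h4 : ENNReal.ofReal (s - 1) ≠ 0 := by simpa using hs
  have h5 := (ENNReal.mul_le_mul_iff_right h4 ENNReal.ofReal_ne_top).1 h3
  have h6 : 0 ≤ edgeWidth K x 1 := by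
    rw [edgeWidth, one_smul, inner_sub_right]
    have := hK.inner_edgeFoot_lt_neg hx
    exact div_nonneg (by linarith) (by positivity)
  exact (ENNReal.ofReal_le_ofReal_iff h6).1 h5

lemma inner_edgeFoot_neg_sub_eq {x : Plane} (hx : IsInnerVector K x) :
    ⟪quarterTurn x, edgeFoot K (-x) - edgeFoot K x⟫ =
      ⟪quarterTurn x, edgeFoot L (-x) - edgeFoot L x⟫ := by
  have h1 := edgeWidth_le hK hL hg hx
  have h2 := edgeWidth_le hL hK hg.symm ((isInnerVector_congr hK hL hg).1 hx)
  have h3 := le_antisymm h2 h1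
  have hn : ‖x‖ ^ 2 ≠ 0 := by have := hx.1; positivity
  simpa [edgeWidth, div_left_inj' hn] using h3

end Comparison

/-! ### The covariogram determines the inscribed parallelograms up to translation -/

/-- The trace of `footSlide n m`, evaluated in the orthogonal frame `(x, quarterTurn x)`, is `-1`:
it is minus the trace of a projection of rank one. -/
lemma inner_footSlide_add_inner_footSlide {n m : Plane} (h : ⟪m, quarterTurn n⟫ ≠ 0) (x : Plane) :
    ⟪x, footSlide n m x⟫ + ⟪quarterTurn x, footSlide n m (quarterTurn x)⟫ = -‖x‖ ^ 2 := by
  rw [footSlide_apply, footSlide_apply, inner_smul_right, inner_smul_right,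
    ← real_inner_self_eq_norm_sq]
  field_simp
  simp only [inner_eq, quarterTurn_apply_zero, quarterTurn_apply_one]
  ring

namespace IsOval

variable {K : Set Plane} (hK : IsOval K)
include hK

lemma hasStrictFDerivAt_edgeFoot_neg {x : Plane} (hx : IsInnerVector K x) :
    HasStrictFDerivAt (fun y => edgeFoot K (-y)) (-edgeFootDeriv K (-x)) x := by
  have h := (hK.hasStrictFDerivAt_edgeFoot hx.neg).comp x (hasStrictFDerivAt_id x).neg
  have he : edgeFootDeriv K (-x) ∘L (-ContinuousLinearMap.id ℝ Plane) = -edgeFootDeriv K (-x) := by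
    ext v; simp
  rw [he] at h
  exact h

lemma edgeFootDeriv_trace {x : Plane} (hx : IsInnerVector K x) (y : Plane) :
    ⟪y, edgeFootDeriv K x y⟫ + ⟪quarterTurn y, edgeFootDeriv K x (quarterTurn y)⟫ = -‖y‖ ^ 2 :=
  inner_footSlide_add_inner_footSlide (hK.inner_unitNormal_ne_zero hx) y

end IsOval

section Comparison

variable {K L : Set Plane} (hK : IsOval K) (hL : IsOval L) (hg : covariogram K = covariogram L)
include hK hL hg

/-- The parallelograms inscribed in `K` and in `L` with the same edge `x` are translates of each
other. The difference `E` of their other edges is parallel to `x` because the widths agree, and its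
derivative has trace zero; together these make `s ↦ ⟪s • x, E (s • x)⟫` constant on `(0, 1]`, and it
tends to `0` at `0` because `E` is bounded. -/
theorem edgeFoot_neg_sub_eq {x : Plane} (hx : IsInnerVector K x) :
    edgeFoot K (-x) - edgeFoot K x = edgeFoot L (-x) - edgeFoot L x := by
  set E : Plane → Plane := fun y =>
    (edgeFoot K (-y) - edgeFoot K y) - (edgeFoot L (-y) - edgeFoot L y) with hE
  have hcongr := fun y => isInnerVector_congr hK hL hg (x := y)
  have hJE : ∀ y, IsInnerVector K y → ⟪quarterTurn y, E y⟫ = 0 := by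
    intro y hy
    rw [hE]
    dsimp only
    rw [inner_sub_right, inner_edgeFoot_neg_sub_eq hK hL hg hy, sub_self]
  set E' : Plane → Plane →L[ℝ] Plane := fun y =>
    (-edgeFootDeriv K (-y) - edgeFootDeriv K y) - (-edgeFootDeriv L (-y) - edgeFootDeriv L y)
    with hE'
  have hder : ∀ y, IsInnerVector K y → HasFDerivAt E (E' y) y := by
    intro y hy
    have hyL := (hcongr y).1 hy
    exact ((hK.hasStrictFDerivAt_edgeFoot_neg hy).hasFDerivAt.sub
      (hK.hasStrictFDerivAt_edgeFoot hy).hasFDerivAt).sub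
      ((hL.hasStrictFDerivAt_edgeFoot_neg hyL).hasFDerivAt.sub
      (hL.hasStrictFDerivAt_edgeFoot hyL).hasFDerivAt)
  have htr : ∀ y, IsInnerVector K y →
      ⟪y, E' y y⟫ + ⟪quarterTurn y, E' y (quarterTurn y)⟫ = 0 := by
    intro y hy
    have hyL := (hcongr y).1 hy
    have h1 := hK.edgeFootDeriv_trace hy y
    have h2 := hK.edgeFootDeriv_trace hy.neg y
    have h3 := hL.edgeFootDeriv_trace hyL y
    have h4 := hL.edgeFootDeriv_trace hyL.neg y
    simp only [hE', sub_apply, neg_apply, inner_sub_right,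
      inner_neg_right]
    linarith
  have hrad : ∀ y, IsInnerVector K y → ⟪y, E y⟫ + ⟪y, E' y y⟫ = 0 := by
    intro y hy
    have h1 : HasFDerivAt (fun z => ⟪quarterTurn z, E z⟫) (0 : Plane →L[ℝ] ℝ) y :=
      (hasFDerivAt_const (0 : ℝ) y).congr_of_eventuallyEq (hy.eventually.mono hJE)
    have h2 := (quarterTurn.hasFDerivAt (x := y)).inner ℝ (hder y hy)
    have h3 := congrArg (fun f => f (quarterTurn y)) (h1.unique h2)
    simp [fderivInnerCLM_apply] at h3
    have h4 := htr y hy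
    linarith
  have hsmul : ∀ s ∈ Ioc (0 : ℝ) 1, IsInnerVector K (s • x) := fun s hs =>
    hK.isInnerVector_smul hx hs.1 hs.2
  set φ : ℝ → ℝ := fun s => ⟪s • x, E (s • x)⟫ with hφ
  have hφ' : ∀ s ∈ Ioc (0 : ℝ) 1, HasDerivAt φ 0 s := by
    intro s hs
    have hi := hsmul s hs
    have h1 : HasDerivAt (fun s : ℝ => s • x) x s := by
      simpa using (hasDerivAt_id s).smul_const x
    have h2 : HasDerivAt (fun s : ℝ => E (s • x)) (E' (s • x) x) s := by
      have h := hder _ hi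
      exact h.comp_hasDerivAt s h1
    have h3 := h1.inner ℝ h2
    have h4 := hrad _ hi
    rw [map_smul, inner_smul_left, inner_smul_left, inner_smul_right] at h4
    simp only [conj_trivial] at h4
    have h5 : s * (⟪x, E (s • x)⟫ + s * ⟪x, E' (s • x) x⟫) = 0 := by linarith
    have h6 := (mul_eq_zero.1 h5).resolve_left hs.1.ne'
    have h7 : ⟪s • x, E' (s • x) x⟫ + ⟪x, E (s • x)⟫ = 0 := by
      rw [real_inner_smul_left]; linarith
    rwa [h7] at h3
  obtain ⟨R, hR⟩ := hK.isCompact.isBounded.exists_norm_le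
  obtain ⟨R', hR'⟩ := hL.isCompact.isBounded.exists_norm_le
  have hconst : ∀ s ∈ Ioc (0 : ℝ) 1, φ s = φ 1 := by
    intro s hs
    refine (constant_of_has_deriv_right_zero (f := φ) (a := s) (b := 1) ?_ ?_ 1
      ⟨hs.2, le_rfl⟩).symm
    · exact fun t ht => (hφ' t ⟨hs.1.trans_le ht.1, ht.2⟩).continuousAt.continuousWithinAt
    · exact fun t ht => (hφ' t ⟨hs.1.trans_le ht.1, ht.2.le⟩).hasDerivWithinAt
  have hbd : ∀ s ∈ Ioc (0 : ℝ) 1, |φ s| ≤ s * (‖x‖ * ((R + R) + (R' + R'))) := by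
    intro s hs
    have hi := hsmul s hs
    have hiL := (hcongr _).1 hi
    refine (abs_real_inner_le_norm _ _).trans ?_
    rw [norm_smul, Real.norm_of_nonneg hs.1.le, mul_assoc]
    have := hs.1.le
    gcongr
    refine (norm_sub_le _ _).trans (add_le_add ((norm_sub_le _ _).trans ?_)
      ((norm_sub_le _ _).trans ?_))
    · exact add_le_add (hR _ (hK.edgeFoot_mem hi.neg)) (hR _ (hK.edgeFoot_mem hi))
    · exact add_le_add (hR' _ (hL.edgeFoot_mem hiL.neg)) (hR' _ (hL.edgeFoot_mem hiL))
  have hφ1 : φ 1 = 0 := by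
    have hlim : Tendsto (fun s : ℝ => s * (‖x‖ * ((R + R) + (R' + R')))) (𝓝[>] 0) (𝓝 0) := by
      have : Continuous (fun s : ℝ => s * (‖x‖ * ((R + R) + (R' + R')))) := by fun_prop
      simpa using (this.tendsto 0).mono_left nhdsWithin_le_nhds
    have : |φ 1| ≤ 0 := ge_of_tendsto hlim (mem_of_superset (Ioc_mem_nhdsGT one_pos)
      fun s hs => by rw [← hconst s hs]; exact hbd s hs)
    exact abs_nonpos_iff.1 this
  rw [hφ] at hφ1
  simp only [one_smul] at hφ1
  exact sub_eq_zero.1 (eq_zero_of_inner hx.1 hφ1 (hJE x hx))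

lemma edgeFootDeriv_add_eq {x : Plane} (hx : IsInnerVector K x) :
    edgeFootDeriv K x + edgeFootDeriv K (-x) = edgeFootDeriv L x + edgeFootDeriv L (-x) := by
  have hxL := (isInnerVector_congr hK hL hg).1 hx
  have h1 := (hK.hasStrictFDerivAt_edgeFoot_neg hx).hasFDerivAt.sub
      (hK.hasStrictFDerivAt_edgeFoot hx).hasFDerivAt
  have h2 := (hL.hasStrictFDerivAt_edgeFoot_neg hxL).hasFDerivAt.sub
      (hL.hasStrictFDerivAt_edgeFoot hxL).hasFDerivAt
  have h3 := h2.congr_of_eventuallyEq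
    (hx.eventually.mono fun y hy => edgeFoot_neg_sub_eq hK hL hg hy)
  have h4 := h1.unique h3
  rw [← neg_inj, neg_add', neg_add', sub_eq_add_neg, sub_eq_add_neg, add_comm,
    add_comm (-edgeFootDeriv L x), ← sub_eq_add_neg, ← sub_eq_add_neg]
  exact h4

/-- Diametral chords of `K` and `L` in the same direction are translates of each other: the set
where the covariogram is positive determines the difference body. -/
lemma supportPoint_sub_supportPoint_neg_eq {u : Plane} (hu : u ≠ 0) :
    supportPoint K u - supportPoint K (-u) = supportPoint L u - supportPoint L (-u) := by
  -- A difference of interior points of one body is a difference of points of the other one.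
  have hsub : ∀ {K L : Set Plane}, IsOval K → IsOval L → covariogram K = covariogram L →
      ∃ p ∈ L, ∃ q ∈ L, supportPoint K u - supportPoint K (-u) = p - q := by
    intro K L hK hL hg
    have hcl : IsClosed (L - L) := (sub_eq_add_neg L L ▸ hL.isCompact.add hL.isCompact.neg).isClosed
    have hint : ∀ p ∈ interior K, ∀ q ∈ interior K, p - q ∈ L - L := by
      intro p hp q hq
      by_cases hpq : p - q = 0
      · rw [hpq]
        obtain ⟨z, hz⟩ := hL.nonempty
        exact ⟨z, hz, z, hz, sub_self z⟩
      · obtain ⟨-, z, hz, hzx⟩ :=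
          (isInnerVector_congr hK hL hg).1 ⟨hpq, q, hq, by simpa using hp⟩
        exact ⟨_, interior_subset hzx, z, interior_subset hz, by simp⟩
    have hmem : supportPoint K u - supportPoint K (-u) ∈ L - L := by
      have h1 : ∀ v, supportPoint K v ∈ closure (interior K) := fun v => by
        rw [hK.closure_interior]; exact hK.supportPoint_mem v
      exact hcl.closure_subset (map_mem_closure₂ continuous_sub (h1 u) (h1 (-u)) hint)
    obtain ⟨p, hp, q, hq, h⟩ := hmem
    exact ⟨p, hp, q, hq, h.symm⟩
  obtain ⟨p, hp, q, hq, h⟩ := hsub hK hL hg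
  obtain ⟨p', hp', q', hq', h'⟩ := hsub hL hK hg.symm
  have i1 := hL.inner_le_supportPoint u hp
  have i2 := hL.inner_le_supportPoint (-u) hq
  have i3 := hK.inner_le_supportPoint u hp'
  have i4 := hK.inner_le_supportPoint (-u) hq'
  have j := congrArg (fun v => ⟪u, v⟫) h
  have j' := congrArg (fun v => ⟪u, v⟫) h'
  simp only [inner_sub_right] at j j'
  rw [inner_neg_left, inner_neg_left] at i2 i4
  have e1 : p = supportPoint L u := hL.eq_supportPoint hp hu fun y hy =>
    (hL.inner_le_supportPoint u hy).trans (by linarith)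
  have e2 : q = supportPoint L (-u) := hL.eq_supportPoint hq (neg_ne_zero.2 hu) fun y hy =>
    (hL.inner_le_supportPoint (-u) hy).trans (by rw [inner_neg_left, inner_neg_left]; linarith)
  rw [h, e1, e2]

/-- If the edge `x` gives a parallelogram in `K` whose diagonal joins the support points of `u` and
`-u`, it does so in `L`. -/
lemma edgeFoot_eq_supportPoint {x u : Plane} (hx : IsInnerVector K x) (hu : u ≠ 0)
    (h : edgeFoot K x = supportPoint K u) (h' : edgeFoot K (-x) = supportPoint K (-u)) :
    edgeFoot L x = supportPoint L u ∧ edgeFoot L (-x) = supportPoint L (-u) := by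
  have hxL := (isInnerVector_congr hK hL hg).1 hx
  have h1 := edgeFoot_neg_sub_eq hK hL hg hx
  have h2 := supportPoint_sub_supportPoint_neg_eq hK hL hg hu
  rw [h, h'] at h1
  have hp := hL.edgeFoot_mem hxL
  have hq := hL.edgeFoot_mem hxL.neg
  have i1 := hL.inner_le_supportPoint u hp
  have i2 := hL.inner_le_supportPoint (-u) hq
  have j1 := congrArg (fun v => ⟪u, v⟫) h1
  have j2 := congrArg (fun v => ⟪u, v⟫) h2
  simp only [inner_sub_right] at j1 j2
  rw [inner_neg_left, inner_neg_left] at i2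
  exact ⟨hL.eq_supportPoint hp hu fun y hy =>
      (hL.inner_le_supportPoint u hy).trans (by linarith),
    hL.eq_supportPoint hq (neg_ne_zero.2 hu) fun y hy =>
      (hL.inner_le_supportPoint (-u) hy).trans (by rw [inner_neg_left, inner_neg_left]; linarith)⟩

end Comparison

/-! ### Rigidity at parallelograms with a diametral diagonal -/

/-- In the frame `(quarterTurn n, n)`, the reciprocal slope of the line orthogonal to `m`. -/
noncomputable def coslope (n m : Plane) : ℝ := -⟪n, m⟫ / ⟪quarterTurn n, m⟫

lemma continuousAt_coslope {X : Type*} [TopologicalSpace X] {n : Plane} {f : X → Plane} {x : X}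
    (hf : ContinuousAt f x) (h : ⟪quarterTurn n, f x⟫ ≠ 0) :
    ContinuousAt (fun y => coslope n (f y)) x :=
  (continuousAt_const.inner hf).neg.div (continuousAt_const.inner hf) h

lemma footSlide_neg_left (n m : Plane) : footSlide (-n) m = footSlide n m := by
  ext1 v
  rw [footSlide_apply, footSlide_apply, map_neg, inner_neg_right, div_neg, neg_neg, smul_neg,
    neg_smul]

lemma footSlide_eq_coslope {n m : Plane} (hn : ‖n‖ = 1) (h : ⟪quarterTurn n, m⟫ ≠ 0) (v : Plane) :
    footSlide n m v = (-⟪quarterTurn n, v⟫ + coslope n m * ⟪n, v⟫) • quarterTurn n := by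
  rw [footSlide_apply, inner_eq_frame hn m v, real_inner_comm (quarterTurn n) m,
    coslope]
  congr 1
  field_simp
  ring

lemma inner_quarterTurn_footSlide (n n₁ m : Plane) :
    ⟪quarterTurn n, footSlide n₁ m (quarterTurn n)⟫ =
      -(⟪m, quarterTurn n⟫ * ⟪n, n₁⟫ / ⟪m, quarterTurn n₁⟫) := by
  rw [footSlide_apply, inner_smul_right, inner_quarterTurn_quarterTurn]; ring

lemma inner_footSlide_quarterTurn (n n₁ m : Plane) :
    ⟪n, footSlide n₁ m (quarterTurn n)⟫ =
      ⟪m, quarterTurn n⟫ * ⟪quarterTurn n, n₁⟫ / ⟪m, quarterTurn n₁⟫ := by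
  rw [footSlide_apply, inner_smul_right, inner_quarterTurn_comm n n₁, real_inner_comm n]; ring

/-- The two coordinates of `footSlide n₁ m (quarterTurn n)` in the frame of `n` satisfy a linear
relation depending on `m` alone, because `footSlide n₁ m v + v` is orthogonal to `m`. -/
lemma inner_quarterTurn_footSlide_add_one {n n₁ m : Plane} (hn : ‖n‖ = 1)
    (h : ⟪m, quarterTurn n₁⟫ ≠ 0) (h' : ⟪quarterTurn n, m⟫ ≠ 0) :
    ⟪quarterTurn n, footSlide n₁ m (quarterTurn n)⟫ + 1 =
      coslope n m * ⟪n, footSlide n₁ m (quarterTurn n)⟫ := by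
  have h1 := inner_footSlide_add h (quarterTurn n)
  have h2 : ⟪quarterTurn n, quarterTurn n⟫ = 1 := by
    rw [inner_quarterTurn_quarterTurn, real_inner_self_eq_norm_sq, hn, one_pow]
  rw [inner_eq_frame hn, inner_add_right, inner_add_right, inner_self_quarterTurn, h2] at h1
  rw [coslope]
  field_simp
  linarith

/-- Along the boundary of a convex body the normal turns in the direction of motion. -/
lemma IsOval.inner_mul_inner_unitNormal_pos {K : Set Plane} (hK : IsOval K) {n p q : Plane}
    (hn : ‖n‖ = 1) (hp : p ∈ K) (hpn : IsOuterNormal K p n) (hq : q ∈ frontier K)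
    (hne : q ≠ p) (hpos : 0 < ⟪n, unitNormal K q⟫) :
    0 < ⟪quarterTurn n, q - p⟫ * ⟪quarterTurn n, unitNormal K q⟫ := by
  have h1 := hpn q (hK.frontier_subset hq)
  have h2 := hK.inner_unitNormal_lt hq hp hne.symm
  have h3 := inner_eq_frame hn (unitNormal K q) (q - p)
  rw [inner_sub_right, inner_sub_right n] at h3
  nlinarith

lemma pos_mul_of_pos_mul_of_pos_mul {a b c : ℝ} (h : 0 < a * b) (h' : 0 < a * c) : 0 < b * c := by
  rcases mul_pos_iff.1 h with ⟨ha, hb⟩ | ⟨ha, hb⟩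
  · exact mul_pos hb ((mul_pos_iff_of_pos_left ha).1 h')
  · exact mul_pos_of_neg_of_neg hb (neg_of_mul_pos_right h' ha.le)

/-- A nonzero linear main term dominates a smaller error. -/
lemma mul_pos_of_abs_sub_le {β X d c : ℝ} (h : |β - X * d| ≤ c * |d|) (hc : c < |X|) (hd : d ≠ 0) :
    0 < β * (X * d) := by
  have hd' := abs_pos.2 hd
  have h1 : |X * d| * |X * d - β| ≤ |X * d| * (c * |d|) := by
    rw [abs_sub_comm]; gcongr
  have hX : 0 < |X * d| := by
    rw [abs_mul]
    have : 0 ≤ c * |d| := (abs_nonneg _).trans h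
    have : 0 ≤ c := by by_contra! hc; nlinarith
    exact mul_pos (by linarith) hd'
  have h2 : |X * d| * (c * |d|) < |X * d| * |X * d| := by
    gcongr
    rw [abs_mul]
    gcongr
  have h3 : (X * d) * (X * d - β) ≤ |X * d| * |X * d - β| := by
    rw [← abs_mul]; exact le_abs_self _
  have h4 : |X * d| * |X * d| = (X * d) * (X * d) := abs_mul_abs_self _
  nlinarith

section Comparison

variable {K L : Set Plane} (hK : IsOval K) (hL : IsOval L) (hg : covariogram K = covariogram L)
include hK hL hg

/-- The derivative of the second edge of the inscribed parallelogram is the same in `K` and `L`. If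
the tangent of `L` at `edgeFoot L y` is orthogonal to `n`, evaluation at `quarterTurn n` gives a
linear relation. Its coefficients are differences of reciprocal slopes; its unknowns vanish when the
tangents of `K` at `edgeFoot K y` and `edgeFoot K (-y)` are orthogonal to `n`. -/
lemma coslope_relation {n y : Plane} (hn : ‖n‖ = 1) (hy : IsInnerVector K y)
    (h2 : ⟪quarterTurn n, unitNormal K (edgeFoot K y + y)⟫ ≠ 0)
    (h4 : ⟪quarterTurn n, unitNormal K (edgeFoot K (-y) + -y)⟫ ≠ 0)
    (h1L : unitNormal L (edgeFoot L y) = n)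
    (h4L : ⟪quarterTurn n, unitNormal L (edgeFoot L (-y) + -y)⟫ ≠ 0) :
    (coslope n (unitNormal K (edgeFoot K y + y)) -
        coslope n (unitNormal L (edgeFoot L (-y) + -y))) *
        ⟪n, edgeFootDeriv K y (quarterTurn n)⟫ +
      (coslope n (unitNormal K (edgeFoot K (-y) + -y)) -
        coslope n (unitNormal L (edgeFoot L (-y) + -y))) *
        ⟪n, edgeFootDeriv K (-y) (quarterTurn n)⟫ = 0 := by
  have hyL := (isInnerVector_congr hK hL hg).1 hy
  have hsum := congrArg (fun A => A (quarterTurn n)) (edgeFootDeriv_add_eq hK hL hg hy)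
  simp only [add_apply] at hsum
  have e1 := congrArg (fun v => ⟪quarterTurn n, v⟫) hsum
  have e2 := congrArg (fun v => ⟪n, v⟫) hsum
  simp only [inner_add_right] at e1 e2
  have r1 := inner_quarterTurn_footSlide_add_one hn (hK.inner_unitNormal_ne_zero hy) h2
  have r2 := inner_quarterTurn_footSlide_add_one hn (hK.inner_unitNormal_ne_zero hy.neg) h4
  have r3 := inner_quarterTurn_footSlide_add_one hn (hL.inner_unitNormal_ne_zero hyL.neg) h4L
  have h1 : ⟪n, edgeFootDeriv L y (quarterTurn n)⟫ = 0 := by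
    rw [edgeFootDeriv, h1L, inner_footSlide]
  have h1' : ⟪quarterTurn n, edgeFootDeriv L y (quarterTurn n)⟫ = -1 := by
    have h2L := hL.inner_unitNormal_ne_zero hyL
    rw [h1L] at h2L
    rw [edgeFootDeriv, h1L, inner_quarterTurn_footSlide, real_inner_self_eq_norm_sq, hn]
    field_simp
  rw [h1, zero_add] at e2
  rw [h1'] at e1
  change ⟪quarterTurn n, edgeFootDeriv K y (quarterTurn n)⟫ + 1 =
    _ * ⟪n, edgeFootDeriv K y (quarterTurn n)⟫ at r1
  change ⟪quarterTurn n, edgeFootDeriv K (-y) (quarterTurn n)⟫ + 1 =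
    _ * ⟪n, edgeFootDeriv K (-y) (quarterTurn n)⟫ at r2
  change ⟪quarterTurn n, edgeFootDeriv L (-y) (quarterTurn n)⟫ + 1 =
    _ * ⟪n, edgeFootDeriv L (-y) (quarterTurn n)⟫ at r3
  rw [← e2] at r3
  linear_combination r3 - r1 - r2 + e1

end Comparison

namespace IsOval

variable {K : Set Plane} (hK : IsOval K)
include hK

/-- The edge of the inscribed parallelogram can be moved while its foot `edgeFoot K x` stays fixed:
move the other end of the edge along the boundary. -/
lemma exists_tendsto_edgeFoot_eq {x : Plane} (hx : IsInnerVector K x) :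
    ∃ f : ℝ → Plane, Tendsto f (𝓝[≠] 0) (𝓝 x) ∧ ∀ᶠ z in 𝓝[≠] (0 : ℝ), f z ≠ x ∧
      edgeFoot K (f z) = edgeFoot K x := by
  set p := edgeFoot K x with hp
  have hq := hK.edgeFoot_add_mem_frontier hx
  rw [← hp] at hq
  set m := unitNormal K (p + x) with hm
  have hm1 : ‖m‖ = 1 := hK.norm_unitNormal hq
  have hm0 : m ≠ 0 := hK.unitNormal_ne_zero hq
  have hmm : ⟪m, m⟫ = 1 := by rw [real_inner_self_eq_norm_sq, hm1, one_pow]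
  set u : ℝ → Plane := fun z => m + z • quarterTurn m with hu
  have hmu : ∀ z, ⟪m, u z⟫ = 1 := by
    intro z; rw [hu]; dsimp only; rw [inner_add_right, inner_smul_right, hmm]; simp
  have hu0 : ∀ z, u z ≠ 0 := by
    intro z h
    have := hmu z
    rw [h, inner_zero_right] at this
    exact zero_ne_one this
  have hut : Tendsto u (𝓝[≠] 0) (𝓝 m) := by
    have : Continuous u := by fun_prop
    simpa [hu] using (this.tendsto 0).mono_left nhdsWithin_le_nhds
  have hft : Tendsto (fun z => supportPoint K (u z) - p) (𝓝[≠] 0) (𝓝 x) := by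
    have h1 := ((hK.continuousAt_supportPoint hm0).tendsto.comp hut).sub_const p
    rw [hm, hK.supportPoint_unitNormal hq, add_sub_cancel_left] at h1
    exact h1
  refine ⟨_, hft, ?_⟩
  have hlim : Tendsto (fun z => edgeFoot K (-(supportPoint K (u z) - p)) -
      (supportPoint K (u z) - p)) (𝓝[≠] 0) (𝓝 (edgeFoot K (-x) - x)) :=
    ((hK.continuousAt_edgeFoot hx.neg).tendsto.comp hft.neg).sub hft
  have hne : edgeFoot K (-x) - x ≠ p := by
    intro h
    have h1 := hK.inner_edgeFoot_lt_neg hx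
    rw [← hp, ← h, inner_sub_right, inner_quarterTurn_self] at h1
    linarith
  filter_upwards [hft.eventually hx.eventually, hlim.eventually (isOpen_ne.mem_nhds hne),
    self_mem_nhdsWithin] with z hz hzne hz0
  constructor
  · intro h
    have h1 : supportPoint K (u z) = p + x := by rw [← h]; abel
    have h2 := hK.unitNormal_supportPoint (hu0 z)
    rw [h1, ← hm] at h2
    have h3 := congrArg (fun v => ⟪quarterTurn m, v⟫) h2
    simp only [inner_quarterTurn_self, inner_smul_right, hu, inner_add_right, zero_add,
      inner_quarterTurn_quarterTurn, hmm, mul_one] at h3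
    rcases mul_eq_zero.1 h3.symm with h4 | h4
    · exact hu0 z (norm_eq_zero.1 (inv_eq_zero.1 h4))
    · exact hz0 h4
  · have h1 : p ∈ frontier K := hK.edgeFoot_mem_frontier hx
    have h2 : p + (supportPoint K (u z) - p) ∈ frontier K := by
      rw [add_sub_cancel]; exact hK.supportPoint_mem_frontier (hu0 z)
    exact ((hK.eq_edgeFoot_or_eq hz h1 h2).resolve_right fun h => hzne h.symm).symm

end IsOval

lemma footSlide_eq_iff_coslope {n m m' : Plane} (hn : ‖n‖ = 1) (h : ⟪quarterTurn n, m⟫ ≠ 0)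
    (h' : ⟪quarterTurn n, m'⟫ ≠ 0) :
    footSlide n m = footSlide n m' ↔ coslope n m = coslope n m' := by
  have hn0 : n ≠ 0 := by rw [← norm_ne_zero_iff, hn]; exact one_ne_zero
  constructor
  · intro he
    have h1 := congrArg (fun A => A n) he
    rw [footSlide_eq_coslope hn h, footSlide_eq_coslope hn h'] at h1
    have h2 := smul_left_injective ℝ (quarterTurn_ne_zero hn0) h1
    simpa [real_inner_self_eq_norm_sq, hn] using h2
  · intro he
    ext1 v
    rw [footSlide_eq_coslope hn h, footSlide_eq_coslope hn h', he]

section Comparison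

variable {K L : Set Plane} (hK : IsOval K) (hL : IsOval L) (hg : covariogram K = covariogram L)
include hK hL hg

/-- Suppose that the parallelogram with edge `x` inscribed in `K` has a diametral diagonal. Then the
tangents at the ends of the other diagonal have the same directions for `K` and for `L`, possibly in
the opposite order.

Otherwise move `x` so that one vertex of the parallelogram in `L`, and hence the slope of its
tangent, stays fixed. The opposite tangents at the diametral vertices in `K` then turn by small
amounts with known signs, and these signs contradict `coslope_relation`. -/
theorem edgeFootDeriv_eq_or_eq {x n : Plane} (hx : IsInnerVector K x) (hn : ‖n‖ = 1)
    (h : edgeFoot K x = supportPoint K n) (h' : edgeFoot K (-x) = supportPoint K (-n)) :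
    edgeFootDeriv K x = edgeFootDeriv L x ∨ edgeFootDeriv K x = edgeFootDeriv L (-x) := by
  have hxL := (isInnerVector_congr hK hL hg).1 hx
  have hn0 : n ≠ 0 := by rw [← norm_ne_zero_iff, hn]; exact one_ne_zero
  have hnn : ⟪n, n⟫ = 1 := by rw [real_inner_self_eq_norm_sq, hn, one_pow]
  obtain ⟨hl, hl'⟩ := edgeFoot_eq_supportPoint hK hL hg hx hn0 h h'
  have b1 : unitNormal K (edgeFoot K x) = n := by
    rw [h, hK.unitNormal_supportPoint hn0, hn, inv_one, one_smul]
  have b3 : unitNormal K (edgeFoot K (-x)) = -n := by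
    rw [h', hK.unitNormal_supportPoint (neg_ne_zero.2 hn0), norm_neg, hn, inv_one, one_smul]
  have c1 : unitNormal L (edgeFoot L x) = n := by
    rw [hl, hL.unitNormal_supportPoint hn0, hn, inv_one, one_smul]
  have c3 : unitNormal L (edgeFoot L (-x)) = -n := by
    rw [hl', hL.unitNormal_supportPoint (neg_ne_zero.2 hn0), norm_neg, hn, inv_one, one_smul]
  -- The normals at the ends of the other diagonal, and their independence of `n`.
  set m₂ := unitNormal K (edgeFoot K x + x) with hm₂
  set m₄ := unitNormal K (edgeFoot K (-x) + -x) with hm₄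
  set l₂ := unitNormal L (edgeFoot L x + x) with hl₂
  set l₄ := unitNormal L (edgeFoot L (-x) + -x) with hl₄
  have d2 : ⟪quarterTurn n, m₂⟫ ≠ 0 := by
    have := hK.inner_unitNormal_ne_zero hx
    rwa [b1, real_inner_comm] at this
  have d4 : ⟪quarterTurn n, m₄⟫ ≠ 0 := by
    have := hK.inner_unitNormal_ne_zero hx.neg
    rwa [b3, real_inner_comm, map_neg, inner_neg_left, neg_ne_zero] at this
  have f2 : ⟪quarterTurn n, l₂⟫ ≠ 0 := by
    have := hL.inner_unitNormal_ne_zero hxL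
    rwa [c1, real_inner_comm] at this
  have f4 : ⟪quarterTurn n, l₄⟫ ≠ 0 := by
    have := hL.inner_unitNormal_ne_zero hxL.neg
    rwa [c3, real_inner_comm, map_neg, inner_neg_left, neg_ne_zero] at this
  have A2 : edgeFootDeriv K x = footSlide n m₂ := by rw [edgeFootDeriv, b1]
  have A4 : edgeFootDeriv K (-x) = footSlide n m₄ := by
    rw [edgeFootDeriv, b3, footSlide_neg_left]
  have B2 : edgeFootDeriv L x = footSlide n l₂ := by rw [edgeFootDeriv, c1]
  have B4 : edgeFootDeriv L (-x) = footSlide n l₄ := by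
    rw [edgeFootDeriv, c3, footSlide_neg_left]
  rw [A2, B2, B4, footSlide_eq_iff_coslope hn d2 f2, footSlide_eq_iff_coslope hn d2 f4]
  have hsum : coslope n m₂ + coslope n m₄ = coslope n l₂ + coslope n l₄ := by
    have := congrArg (fun A => ⟪quarterTurn n, A n⟫) (edgeFootDeriv_add_eq hK hL hg hx)
    simp only [A2, A4, B2, B4, add_apply] at this
    rw [footSlide_eq_coslope hn d2, footSlide_eq_coslope hn d4, footSlide_eq_coslope hn f2,
      footSlide_eq_coslope hn f4] at this
    simpa [hnn, inner_add_right, inner_smul_right, hn] using this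
  by_contra! hne
  -- If the edge moves by `y - x` while the vertex `edgeFoot L x` is fixed, then up to first order
  -- the two diametral vertices of `K` move along the boundary by `X` and `Y` times `⟪n, y - x⟫`.
  set X := coslope n m₂ - coslope n l₂ with hX
  set Y := coslope n m₂ - coslope n l₄ with hY
  have hX0 : X ≠ 0 := sub_ne_zero.2 hne.1
  have hY0 : Y ≠ 0 := sub_ne_zero.2 hne.2
  have hY' : Y = coslope n l₂ - coslope n m₄ := by rw [hY]; linarith
  have hX' : coslope n m₄ - coslope n l₄ = -X := by rw [hX]; linarith
  -- By continuity, for `y` near `x` the coefficients of `coslope_relation` have the signs of `Y`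
  -- and `-X`, and no normal used below degenerates.
  have k1 := hK.continuousAt_unitNormal_edgeFoot hx
  have k2 := hK.continuousAt_unitNormal_edgeFoot_add hx
  have k3 : ContinuousAt (fun y => unitNormal K (edgeFoot K (-y))) x :=
    ContinuousAt.comp (f := fun y : Plane => -y) (hK.continuousAt_unitNormal_edgeFoot hx.neg)
      continuousAt_neg
  have k4 : ContinuousAt (fun y => unitNormal K (edgeFoot K (-y) + -y)) x :=
    ContinuousAt.comp (f := fun y : Plane => -y) (hK.continuousAt_unitNormal_edgeFoot_add hx.neg)
      continuousAt_neg
  have k5 : ContinuousAt (fun y => unitNormal L (edgeFoot L (-y) + -y)) x :=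
    ContinuousAt.comp (f := fun y : Plane => -y) (hL.continuousAt_unitNormal_edgeFoot_add hxL.neg)
      continuousAt_neg
  have o2 : ∀ᶠ y in 𝓝 x, ⟪quarterTurn n, unitNormal K (edgeFoot K y + y)⟫ ≠ 0 :=
    (continuousAt_const.inner k2).eventually_ne d2
  have o4 : ∀ᶠ y in 𝓝 x, ⟪quarterTurn n, unitNormal K (edgeFoot K (-y) + -y)⟫ ≠ 0 :=
    (continuousAt_const.inner k4).eventually_ne d4
  have o5 : ∀ᶠ y in 𝓝 x, ⟪quarterTurn n, unitNormal L (edgeFoot L (-y) + -y)⟫ ≠ 0 :=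
    (continuousAt_const.inner k5).eventually_ne f4
  have pos_of_tendsto : ∀ {φ : Plane → ℝ}, ContinuousAt φ x → 0 < φ x → ∀ᶠ y in 𝓝 x, 0 < φ y :=
    fun hφ h0 => hφ.eventually (isOpen_Ioi.mem_nhds h0)
  have o1 : ∀ᶠ y in 𝓝 x, 0 < ⟪n, unitNormal K (edgeFoot K y)⟫ :=
    pos_of_tendsto (continuousAt_const.inner k1) (by rw [b1, hnn]; exact one_pos)
  have o3 : ∀ᶠ y in 𝓝 x, 0 < ⟪-n, unitNormal K (edgeFoot K (-y))⟫ :=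
    pos_of_tendsto (continuousAt_const.inner k3)
      (by rw [b3, inner_neg_neg, hnn]; exact one_pos)
  have oC1 : ∀ᶠ y in 𝓝 x, 0 < (coslope n (unitNormal K (edgeFoot K y + y)) -
      coslope n (unitNormal L (edgeFoot L (-y) + -y))) * Y :=
    pos_of_tendsto (((continuousAt_coslope k2 d2).sub (continuousAt_coslope k5 f4)).mul
      continuousAt_const) (mul_self_pos.2 hY0)
  have oC3 : ∀ᶠ y in 𝓝 x, 0 < (coslope n (unitNormal K (edgeFoot K (-y) + -y)) -
      coslope n (unitNormal L (edgeFoot L (-y) + -y))) * -X :=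
    pos_of_tendsto (((continuousAt_coslope k4 d4).sub (continuousAt_coslope k5 f4)).mul
      continuousAt_const) (by rw [← hX']; exact mul_self_pos.2 (by rw [hX']; simpa using hX0))
  have oρ1 : ∀ᶠ y in 𝓝 x, 0 < ⟪unitNormal K (edgeFoot K y + y), quarterTurn n⟫ /
      ⟪unitNormal K (edgeFoot K y + y), quarterTurn (unitNormal K (edgeFoot K y))⟫ := by
    refine pos_of_tendsto ((k2.inner continuousAt_const).div
      (k2.inner (quarterTurn.continuous.continuousAt.comp k1))
      (hK.inner_unitNormal_ne_zero hx)) ?_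
    rw [← hm₂, b1, div_self]
    · exact one_pos
    · rwa [real_inner_comm]
  have oρ3 : ∀ᶠ y in 𝓝 x, 0 < -(⟪unitNormal K (edgeFoot K (-y) + -y), quarterTurn n⟫ /
      ⟪unitNormal K (edgeFoot K (-y) + -y), quarterTurn (unitNormal K (edgeFoot K (-y)))⟫) := by
    refine pos_of_tendsto ((k4.inner continuousAt_const).div
      (k4.inner (quarterTurn.continuous.continuousAt.comp k3))
      (hK.inner_unitNormal_ne_zero hx.neg)).neg ?_
    rw [← hm₄, b3, map_neg, inner_neg_right, div_neg, neg_neg, div_self]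
    · exact one_pos
    · rwa [real_inner_comm]
  -- First order expansions of the displacements; `ε` is so small that the errors do not change the
  -- signs of the main terms `X * ⟪n, y - x⟫` and `Y * ⟪n, y - x⟫`.
  obtain ⟨ε, hε, hε1, hεX, hεY⟩ : ∃ ε : ℝ, 0 < ε ∧ ε ≤ 1 / 2 ∧
      4 * ε * (|coslope n l₂| + 1) < |X| ∧ 4 * ε * (|coslope n l₂| + 1) < |Y| := by
    have hT : Tendsto (fun ε : ℝ => 4 * ε * (|coslope n l₂| + 1)) (𝓝[>] 0) (𝓝 0) := by
      have : Continuous (fun ε : ℝ => 4 * ε * (|coslope n l₂| + 1)) := by fun_prop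
      simpa using (this.tendsto 0).mono_left nhdsWithin_le_nhds
    obtain ⟨ε, ⟨h1, h2⟩, h3⟩ := ((hT.eventually (gt_mem_nhds (abs_pos.2 hX0))).and
      (hT.eventually (gt_mem_nhds (abs_pos.2 hY0)))).and
      (Ioc_mem_nhdsGT (show (0 : ℝ) < 1 / 2 by norm_num)) |>.exists
    exact ⟨ε, h3.1, h3.2, h1, h2⟩
  have oβ1 : ∀ᶠ y in 𝓝 x, ‖edgeFoot K y - edgeFoot K x - footSlide n m₂ (y - x)‖ ≤ ε * ‖y - x‖ := by
    rw [← A2]; exact (hK.hasStrictFDerivAt_edgeFoot hx).hasFDerivAt.isLittleO.def hε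
  have oβ3 : ∀ᶠ y in 𝓝 x,
      ‖edgeFoot K (-y) - edgeFoot K (-x) - (-footSlide n m₄) (y - x)‖ ≤ ε * ‖y - x‖ := by
    rw [← A4]; exact (hK.hasStrictFDerivAt_edgeFoot_neg hx).hasFDerivAt.isLittleO.def hε
  have hq := hL.edgeFoot_add_mem_frontier hxL
  have oδ : ∀ᶠ y in 𝓝 x, edgeFoot L x + y ∈ frontier L →
      |⟪l₂, y - x⟫| ≤ ε * |⟪quarterTurn n, l₂⟫| * ‖y - x‖ := by
    have hc : Tendsto (fun y => (edgeFoot L x + y, edgeFoot L x + x)) (𝓝 x)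
        (𝓝 (edgeFoot L x + x, edgeFoot L x + x)) := by
      have : Continuous (fun y => (edgeFoot L x + y, edgeFoot L x + x)) := by fun_prop
      exact this.tendsto x
    filter_upwards [hc.eventually (hL.eventually_abs_inner_unitNormal_le hq
      (mul_pos hε (abs_pos.2 f2)))] with y hy hyf
    simpa using hy hyf hq
  obtain ⟨f, hf, hfe⟩ := hL.exists_tendsto_edgeFoot_eq hxL
  obtain ⟨z, ⟨hzx, hzL⟩, hall⟩ := (hfe.and (hf.eventually (hx.eventually.and (o1.and (o2.and
    (o3.and (o4.and (o5.and (oC1.and (oC3.and (oρ1.and (oρ3.and (oβ1.and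
      (oβ3.and oδ)))))))))))))).exists
  obtain ⟨hy, o1, o2, o3, o4, o5, oC1, oC3, oρ1, oρ3, oβ1, oβ3, oδ⟩ := hall
  generalize f z = y at *
  have hyL := (isInnerVector_congr hK hL hg).1 hy
  replace oδ := oδ (by rw [← hzL]; exact hL.edgeFoot_add_mem_frontier hyL)
  have hrel := coslope_relation hK hL hg hn hy o2 o4 (by rw [hzL, c1]) o5
  rw [edgeFootDeriv, edgeFootDeriv, inner_footSlide_quarterTurn, inner_footSlide_quarterTurn]
    at hrel
  set d₁ := ⟪quarterTurn n, y - x⟫ with hd₁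
  set d₂ := ⟪n, y - x⟫ with hd₂
  have hδ : |d₁ - coslope n l₂ * d₂| ≤ ε * ‖y - x‖ := by
    have h1 : ⟪l₂, y - x⟫ = ⟪quarterTurn n, l₂⟫ * (d₁ - coslope n l₂ * d₂) := by
      rw [inner_eq_frame hn, coslope]; field_simp; ring
    rw [h1, abs_mul] at oδ
    have h2 := abs_pos.2 f2
    have : |⟪quarterTurn n, l₂⟫| * |d₁ - coslope n l₂ * d₂| ≤
        |⟪quarterTurn n, l₂⟫| * (ε * ‖y - x‖) := by linarith
    exact le_of_mul_le_mul_left this h2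
  have hnorm : ‖y - x‖ ≤ 2 * (|coslope n l₂| + 1) * |d₂| := by
    have h1 : ‖y - x‖ ≤ |d₂| + |d₁| := by
      conv_lhs => rw [eq_inner_smul_add hn (y - x)]
      refine (norm_add_le _ _).trans ?_
      simp [norm_smul, hn, hd₁, hd₂]
    have h2 : |d₁| ≤ |d₁ - coslope n l₂ * d₂| + |coslope n l₂ * d₂| := by
      simpa using abs_add_le (d₁ - coslope n l₂ * d₂) (coslope n l₂ * d₂)
    rw [abs_mul] at h2
    have h3 : ε * ‖y - x‖ ≤ 1 / 2 * ‖y - x‖ := by gcongr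
    linarith
  have hd₂0 : d₂ ≠ 0 := by
    intro h0
    rw [h0, abs_zero, mul_zero] at hnorm
    exact hzx (sub_eq_zero.1 (norm_le_zero_iff.1 hnorm))
  have hJ1 : ‖quarterTurn n‖ = 1 := by rw [norm_quarterTurn, hn]
  have hJabs : ∀ v, |⟪quarterTurn n, v⟫| ≤ ‖v‖ := fun v => by
    simpa [hJ1] using abs_real_inner_le_norm (quarterTurn n) v
  have hJJ : ⟪quarterTurn n, quarterTurn n⟫ = 1 := by rw [inner_quarterTurn_quarterTurn, hnn]
  have hβ1 : |⟪quarterTurn n, edgeFoot K y - edgeFoot K x⟫ - X * d₂| ≤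
      4 * ε * (|coslope n l₂| + 1) * |d₂| := by
    have h1 := (hJabs _).trans oβ1
    rw [inner_sub_right (quarterTurn n) (edgeFoot K y - edgeFoot K x),
      footSlide_eq_coslope hn d2, inner_smul_right, hJJ, mul_one, ← hd₁, ← hd₂] at h1
    have h2 := abs_sub (⟪quarterTurn n, edgeFoot K y - edgeFoot K x⟫ -
      (-d₁ + coslope n m₂ * d₂)) (d₁ - coslope n l₂ * d₂)
    have h3 : ⟪quarterTurn n, edgeFoot K y - edgeFoot K x⟫ - X * d₂ =
        ⟪quarterTurn n, edgeFoot K y - edgeFoot K x⟫ -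
      (-d₁ + coslope n m₂ * d₂) - (d₁ - coslope n l₂ * d₂) := by rw [hX]; ring
    rw [h3]
    have h4 : ε * ‖y - x‖ ≤ ε * (2 * (|coslope n l₂| + 1) * |d₂|) := by gcongr
    linarith
  have hβ3 : |⟪quarterTurn n, edgeFoot K (-y) - edgeFoot K (-x)⟫ - Y * d₂| ≤
      4 * ε * (|coslope n l₂| + 1) * |d₂| := by
    have h1 := (hJabs _).trans oβ3
    rw [inner_sub_right (quarterTurn n) (edgeFoot K (-y) - edgeFoot K (-x)), neg_apply,
      inner_neg_right,
      footSlide_eq_coslope hn d4, inner_smul_right, hJJ, mul_one, ← hd₁, ← hd₂] at h1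
    have h2 := abs_add_le (⟪quarterTurn n, edgeFoot K (-y) - edgeFoot K (-x)⟫ -
      -(-d₁ + coslope n m₄ * d₂)) (d₁ - coslope n l₂ * d₂)
    have h3 : ⟪quarterTurn n, edgeFoot K (-y) - edgeFoot K (-x)⟫ - Y * d₂ =
        ⟪quarterTurn n, edgeFoot K (-y) - edgeFoot K (-x)⟫ -
      -(-d₁ + coslope n m₄ * d₂) + (d₁ - coslope n l₂ * d₂) := by rw [hY']; ring
    rw [h3]
    have h4 : ε * ‖y - x‖ ≤ ε * (2 * (|coslope n l₂| + 1) * |d₂|) := by gcongr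
    linarith
  have hp1 := mul_pos_of_abs_sub_le hβ1 hεX hd₂0
  have hp3 := mul_pos_of_abs_sub_le hβ3 hεY hd₂0
  have hne1 : edgeFoot K y ≠ edgeFoot K x := by
    intro h0; rw [h0, sub_self, inner_zero_right, zero_mul] at hp1; exact lt_irrefl _ hp1
  have hne3 : edgeFoot K (-y) ≠ edgeFoot K (-x) := by
    intro h0; rw [h0, sub_self, inner_zero_right, zero_mul] at hp3; exact lt_irrefl _ hp3
  have ht1 := hK.inner_mul_inner_unitNormal_pos hn (hK.edgeFoot_mem hx)
    (by rw [h]; exact hK.isOuterNormal_supportPoint n) (hK.edgeFoot_mem_frontier hy) hne1 o1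
  have ht3 := hK.inner_mul_inner_unitNormal_pos (n := -n) (by rw [norm_neg, hn])
    (hK.edgeFoot_mem hx.neg) (by rw [h']; exact hK.isOuterNormal_supportPoint (-n))
    (hK.edgeFoot_mem_frontier hy.neg) hne3 o3
  rw [map_neg, inner_neg_left, inner_neg_left, neg_mul_neg] at ht3
  rw [mul_div_right_comm, mul_div_right_comm] at hrel
  -- After multiplication by `X * Y * ⟪n, y - x⟫` both terms of the linear relation are positive.
  generalize ⟪quarterTurn n, edgeFoot K y - edgeFoot K x⟫ = β₁ at *
  generalize ⟪quarterTurn n, edgeFoot K (-y) - edgeFoot K (-x)⟫ = β₃ at *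
  generalize ⟪quarterTurn n, unitNormal K (edgeFoot K y)⟫ = P₁ at *
  generalize ⟪quarterTurn n, unitNormal K (edgeFoot K (-y))⟫ = P₃ at *
  have q1 := pos_mul_of_pos_mul_of_pos_mul ht1 hp1
  have q3 := pos_mul_of_pos_mul_of_pos_mul ht3 hp3
  have t1 := mul_pos (mul_pos oC1 q1) oρ1
  have t3 := mul_pos (mul_pos oC3 q3) oρ3
  have := congrArg (fun a => X * Y * d₂ * a) hrel
  simp only [mul_zero] at this
  linarith

end Comparison

/-! ### Boundary arcs swept by diametral parallelograms -/

/-- A function whose increments are negligible compared with those of `τ` is constant. -/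
lemma eq_of_forall_eventually_norm_sub_le {E : Type*} [NormedAddCommGroup E] {w : ℝ → E}
    {τ : ℝ → ℝ} {b : ℝ} (hw : ContinuousOn w (Icc 0 b)) (hτ : ContinuousOn τ (Icc 0 b))
    (h : ∀ z ∈ Ico 0 b, ∀ ε > 0, ∀ᶠ z' in 𝓝[>] z, ‖w z' - w z‖ ≤ ε * (τ z' - τ z)) :
    ∀ z ∈ Icc 0 b, w z = w 0 := by
  intro z hz
  have key : ∀ ε > 0, ‖w z - w 0‖ ≤ ε * (τ z - τ 0) := by
    intro ε hε
    set S := {z | ‖w z - w 0‖ ≤ ε * (τ z - τ 0)} with hS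
    have hcl : IsClosed (S ∩ Icc 0 b) := by
      rw [inter_comm]
      exact isClosed_Icc.isClosed_le (hw.sub continuousOn_const).norm
        (continuousOn_const.mul (hτ.sub continuousOn_const))
    refine hcl.Icc_subset_of_forall_exists_gt (by simp [hS]) ?_ hz
    rintro y ⟨hyS, hy⟩ v hv
    obtain ⟨y', h1, h2⟩ := ((h y hy ε hε).and (Ioc_mem_nhdsGT hv)).exists
    refine ⟨y', ?_, h2⟩
    have h3 : ‖w y - w 0‖ ≤ ε * (τ y - τ 0) := hyS
    have h4 : ‖w y' - w 0‖ ≤ ‖w y' - w y‖ + ‖w y - w 0‖ := by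
      simpa using norm_add_le (w y' - w y) (w y - w 0)
    change ‖w y' - w 0‖ ≤ ε * (τ y' - τ 0)
    linarith
  have hlim : Tendsto (fun ε : ℝ => ε * (τ z - τ 0)) (𝓝[>] 0) (𝓝 0) := by
    have : Continuous (fun ε : ℝ => ε * (τ z - τ 0)) := by fun_prop
    simpa using (this.tendsto 0).mono_left nhdsWithin_le_nhds
  have : ‖w z - w 0‖ ≤ 0 := ge_of_tendsto hlim (mem_of_superset self_mem_nhdsWithin key)
  exact sub_eq_zero.1 (norm_le_zero_iff.1 this)

/-- The normal direction `n` turned towards `quarterTurn n`; `z` is the tangent of the angle. -/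
noncomputable def tilt (n : Plane) (z : ℝ) : Plane := n + z • quarterTurn n

lemma continuous_tilt (n : Plane) : Continuous (tilt n) := by unfold tilt; fun_prop

lemma tilt_zero (n : Plane) : tilt n 0 = n := by simp [tilt]

lemma inner_tilt {n : Plane} (hn : ‖n‖ = 1) (z : ℝ) : ⟪n, tilt n z⟫ = 1 := by
  simp [tilt, inner_add_right, inner_smul_right, hn]

lemma inner_quarterTurn_tilt {n : Plane} (hn : ‖n‖ = 1) (z : ℝ) :
    ⟪quarterTurn n, tilt n z⟫ = z := by
  simp [tilt, inner_add_right, inner_smul_right, hn]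

lemma tilt_ne_zero {n : Plane} (hn : ‖n‖ = 1) (z : ℝ) : tilt n z ≠ 0 := by
  intro h
  have := inner_tilt hn z
  rw [h, inner_zero_right] at this
  exact zero_ne_one this

namespace IsOval

variable {K : Set Plane} (hK : IsOval K)
include hK

lemma supportPoint_smul {u : Plane} (hu : u ≠ 0) {c : ℝ} (hc : 0 < c) :
    supportPoint K (c • u) = supportPoint K u :=
  (hK.eq_supportPoint (hK.supportPoint_mem u) (smul_ne_zero hc.ne' hu)
    ((hK.isOuterNormal_supportPoint u).smul hc.le)).symm

lemma continuous_supportPoint_tilt {n : Plane} (hn : ‖n‖ = 1) :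
    Continuous fun z => supportPoint K (tilt n z) :=
  continuous_iff_continuousAt.2 fun z =>
    (hK.continuousAt_supportPoint (tilt_ne_zero hn z)).comp (continuous_tilt n).continuousAt

lemma continuous_supportPoint_neg_tilt {n : Plane} (hn : ‖n‖ = 1) :
    Continuous fun z => supportPoint K (-tilt n z) :=
  continuous_iff_continuousAt.2 fun z =>
    (hK.continuousAt_supportPoint (neg_ne_zero.2 (tilt_ne_zero hn z))).comp
      (f := fun z => -tilt n z) (continuous_tilt n).neg.continuousAt

lemma inner_supportPoint_tilt_mono (n : Plane) {z z' : ℝ} (h : z < z') :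
    ⟪quarterTurn n, supportPoint K (tilt n z)⟫ ≤ ⟪quarterTurn n, supportPoint K (tilt n z')⟫ := by
  have h1 := hK.inner_le_supportPoint (tilt n z) (hK.supportPoint_mem (tilt n z'))
  have h2 := hK.inner_le_supportPoint (tilt n z') (hK.supportPoint_mem (tilt n z))
  simp only [tilt, inner_add_left, real_inner_smul_left] at h1 h2 ⊢
  nlinarith

lemma inner_supportPoint_neg_tilt_anti (n : Plane) {z z' : ℝ} (h : z < z') :
    ⟪quarterTurn n, supportPoint K (-tilt n z')⟫ ≤
      ⟪quarterTurn n, supportPoint K (-tilt n z)⟫ := by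
  have h1 := hK.inner_le_supportPoint (-tilt n z) (hK.supportPoint_mem (-tilt n z'))
  have h2 := hK.inner_le_supportPoint (-tilt n z') (hK.supportPoint_mem (-tilt n z))
  simp only [tilt, inner_neg_left, inner_add_left, real_inner_smul_left] at h1 h2 ⊢
  nlinarith

/-- Near a boundary point the boundary is a graph over the tangent. -/
lemma eventually_eq_of_inner_quarterTurn_eq {p n : Plane} (hn : ‖n‖ = 1) (hp : p ∈ frontier K)
    (hpn : IsOuterNormal K p n) : ∀ᶠ q : Plane × Plane in 𝓝 (p, p), q.1 ∈ frontier K →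
      q.2 ∈ frontier K → ⟪quarterTurn n, q.1⟫ = ⟪quarterTurn n, q.2⟫ → q.1 = q.2 := by
  have h := hK.eventually_abs_inner_unitNormal_le hp (show (0 : ℝ) < 1 / 2 by norm_num)
  rw [← hK.eq_unitNormal hp hn hpn] at h
  filter_upwards [h] with q hq h1 h2 heq
  have h3 := hq h1 h2
  have h4 : ⟪quarterTurn n, q.1 - q.2⟫ = 0 := by rw [inner_sub_right, heq, sub_self]
  have h5 : ‖q.1 - q.2‖ = |⟪n, q.1 - q.2⟫| := by
    conv_lhs => rw [eq_inner_smul_add hn (q.1 - q.2), h4]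
    simp [norm_smul, hn]
  have h6 : ‖q.1 - q.2‖ ≤ 0 := by linarith
  exact sub_eq_zero.1 (norm_le_zero_iff.1 h6)

/-- If the tangents at the ends of the second diagonal of a parallelogram with a diametral diagonal
are not parallel, then the parallelogram extends to a family of such parallelograms, by the
inverse function theorem; its edge is a Lipschitz function of the diametral diagonal. -/
lemma exists_diametral_family {x n : Plane} (hx : IsInnerVector K x) (hn : ‖n‖ = 1)
    (h : edgeFoot K x = supportPoint K n) (h' : edgeFoot K (-x) = supportPoint K (-n))
    (hne : edgeFootDeriv K x ≠ edgeFootDeriv K (-x)) :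
    ∃ (X : ℝ → Plane) (C : ℝ), 0 ≤ C ∧ Tendsto X (𝓝 0) (𝓝 x) ∧ ∃ s ∈ 𝓝 (0 : ℝ), ∀ z ∈ s,
      (IsInnerVector K (X z) ∧ edgeFoot K (X z) = supportPoint K (tilt n z) ∧
        edgeFoot K (-X z) = supportPoint K (-tilt n z)) ∧
      ∀ z' ∈ s, z < z' → ‖X z' - X z‖ ≤
        C * ((⟪quarterTurn n, supportPoint K (tilt n z')⟫ -
            ⟪quarterTurn n, supportPoint K (-tilt n z')⟫) -
          (⟪quarterTurn n, supportPoint K (tilt n z)⟫ -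
            ⟪quarterTurn n, supportPoint K (-tilt n z)⟫)) := by
  have hn0 : n ≠ 0 := by rw [← norm_ne_zero_iff, hn]; exact one_ne_zero
  have hnn : ⟪n, n⟫ = 1 := by rw [real_inner_self_eq_norm_sq, hn, one_pow]
  have hJJ : ⟪quarterTurn n, quarterTurn n⟫ = 1 := by rw [inner_quarterTurn_quarterTurn, hnn]
  have b1 : unitNormal K (edgeFoot K x) = n := by
    rw [h, hK.unitNormal_supportPoint hn0, hn, inv_one, one_smul]
  have b3 : unitNormal K (edgeFoot K (-x)) = -n := by
    rw [h', hK.unitNormal_supportPoint (neg_ne_zero.2 hn0), norm_neg, hn, inv_one, one_smul]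
  set m₂ := unitNormal K (edgeFoot K x + x) with hm₂
  set m₄ := unitNormal K (edgeFoot K (-x) + -x) with hm₄
  have d2 : ⟪quarterTurn n, m₂⟫ ≠ 0 := by
    have := hK.inner_unitNormal_ne_zero hx
    rwa [b1, real_inner_comm] at this
  have d4 : ⟪quarterTurn n, m₄⟫ ≠ 0 := by
    have := hK.inner_unitNormal_ne_zero hx.neg
    rwa [b3, real_inner_comm, map_neg, inner_neg_left, neg_ne_zero] at this
  have A2 : edgeFootDeriv K x = footSlide n m₂ := by rw [edgeFootDeriv, b1]
  have A4 : edgeFootDeriv K (-x) = footSlide n m₄ := by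
    rw [edgeFootDeriv, b3, footSlide_neg_left]
  have hs : coslope n m₂ ≠ coslope n m₄ := by
    rw [A2, A4] at hne
    exact fun he => hne ((footSlide_eq_iff_coslope hn d2 d4).2 he)
  -- The tangential coordinates of the two diametral vertices, as functions of the edge.
  set φ : Plane → Plane := fun y => ⟪quarterTurn n, edgeFoot K y⟫ • quarterTurn n +
    ⟪quarterTurn n, edgeFoot K (-y)⟫ • n with hφ
  set B : Plane →L[ℝ] Plane :=
    ((innerSL ℝ (quarterTurn n)).comp (footSlide n m₂)).smulRight (quarterTurn n) +
      ((innerSL ℝ (quarterTurn n)).comp (-footSlide n m₄)).smulRight n with hB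
  have hBφ : HasStrictFDerivAt φ B x := by
    have h1 := hK.hasStrictFDerivAt_edgeFoot hx
    have h2 := hK.hasStrictFDerivAt_edgeFoot_neg hx
    rw [A2] at h1
    rw [A4] at h2
    exact (((innerSL ℝ (quarterTurn n)).hasStrictFDerivAt.comp x h1).smul_const _).add
      (((innerSL ℝ (quarterTurn n)).hasStrictFDerivAt.comp x h2).smul_const _)
  have hBv : ∀ v, B v = (-⟪quarterTurn n, v⟫ + coslope n m₂ * ⟪n, v⟫) • quarterTurn n +
      (⟪quarterTurn n, v⟫ - coslope n m₄ * ⟪n, v⟫) • n := by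
    intro v
    simp only [hB, add_apply, ContinuousLinearMap.smulRight_apply, ContinuousLinearMap.comp_apply,
      innerSL_apply_apply, neg_apply, footSlide_eq_coslope hn d2, footSlide_eq_coslope hn d4,
      inner_neg_right, inner_smul_right, hJJ]
    congr 2 <;> ring
  have hinj : Function.Injective B := by
    rw [injective_iff_map_eq_zero]
    intro v hv
    rw [hBv] at hv
    have e1 := congrArg (fun w => ⟪quarterTurn n, w⟫) hv
    have e2 := congrArg (fun w => ⟪n, w⟫) hv
    simp only [inner_add_right, inner_smul_right, hJJ, hnn, inner_quarterTurn_self,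
      inner_self_quarterTurn, inner_zero_right, mul_one, mul_zero, add_zero, zero_add] at e1 e2
    have e3 : (coslope n m₂ - coslope n m₄) * ⟪n, v⟫ = 0 := by linarith
    have e4 := (mul_eq_zero.1 e3).resolve_left (sub_ne_zero.2 hs)
    exact eq_zero_of_inner hn0 e4 (by rw [e4] at e1; linarith)
  set Be : Plane ≃L[ℝ] Plane :=
    (LinearEquiv.ofInjectiveEndo (B : Plane →ₗ[ℝ] Plane) hinj).toContinuousLinearEquiv with hBe
  have hBe' : (Be : Plane →L[ℝ] Plane) = B := by ext1 v; rfl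
  rw [← hBe'] at hBφ
  set ψ := hBφ.localInverse φ Be x
  have hψ0 : Tendsto ψ (𝓝 (φ x)) (𝓝 x) := hBφ.localInverse_tendsto
  have hψ1 : ∀ᶠ y in 𝓝 (φ x), φ (ψ y) = y := hBφ.eventually_right_inverse
  obtain ⟨C, S, hS, hlip⟩ := hBφ.to_localInverse.exists_lipschitzOnWith
  set T : ℝ → Plane := fun z => ⟪quarterTurn n, supportPoint K (tilt n z)⟫ • quarterTurn n +
    ⟪quarterTurn n, supportPoint K (-tilt n z)⟫ • n with hT
  have cp := hK.continuous_supportPoint_tilt hn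
  have cm := hK.continuous_supportPoint_neg_tilt hn
  have hTt : Tendsto T (𝓝 0) (𝓝 (φ x)) := by
    have i1 : Continuous fun z => ⟪quarterTurn n, supportPoint K (tilt n z)⟫ :=
      continuous_const.inner cp
    have i3 : Continuous fun z => ⟪quarterTurn n, supportPoint K (-tilt n z)⟫ :=
      continuous_const.inner cm
    have hTc : Continuous T := (i1.smul continuous_const).add (i3.smul continuous_const)
    have h0 : T 0 = φ x := by rw [hT, hφ]; dsimp only; rw [tilt_zero, h, h']
    rw [← h0]
    exact hTc.tendsto 0
  have hXt : Tendsto (fun z => ψ (T z)) (𝓝 0) (𝓝 x) := hψ0.comp hTt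
  refine ⟨fun z => ψ (T z), C, C.2, hXt, ?_⟩
  have hp := hK.edgeFoot_mem_frontier hx
  have hp' := hK.edgeFoot_mem_frontier hx.neg
  have cp0 : Tendsto (fun z => supportPoint K (tilt n z)) (𝓝 0) (𝓝 (edgeFoot K x)) := by
    have := cp.tendsto 0
    rwa [tilt_zero, ← h] at this
  have cm0 : Tendsto (fun z => supportPoint K (-tilt n z)) (𝓝 0) (𝓝 (edgeFoot K (-x))) := by
    have := cm.tendsto 0
    rwa [tilt_zero, ← h'] at this
  have t1 : Tendsto (fun z => (edgeFoot K (ψ (T z)), supportPoint K (tilt n z))) (𝓝 0)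
      (𝓝 (edgeFoot K x, edgeFoot K x)) := by
    rw [nhds_prod_eq]; exact ((hK.continuousAt_edgeFoot hx).tendsto.comp hXt).prodMk cp0
  have t3 : Tendsto (fun z => (edgeFoot K (-ψ (T z)), supportPoint K (-tilt n z))) (𝓝 0)
      (𝓝 (edgeFoot K (-x), edgeFoot K (-x))) := by
    rw [nhds_prod_eq]
    exact ((hK.continuousAt_edgeFoot hx.neg).tendsto.comp hXt.neg).prodMk cm0
  have g1 := t1.eventually (hK.eventually_eq_of_inner_quarterTurn_eq hn hp
    (by rw [h]; exact hK.isOuterNormal_supportPoint n))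
  have g3 := t3.eventually (hK.eventually_eq_of_inner_quarterTurn_eq (n := -n)
    (by rw [norm_neg, hn]) hp' (by rw [h']; exact hK.isOuterNormal_supportPoint (-n)))
  have hall := (hXt.eventually hx.eventually).and (g1.and (g3.and ((hTt.eventually hψ1).and
    (hTt.eventually hS))))
  refine ⟨_, hall, ?_⟩
  rintro z ⟨hz1, hz2, hz3, hz4, hz5⟩
  have hz0 := tilt_ne_zero hn z
  have e1 := congrArg (fun w => ⟪quarterTurn n, w⟫) hz4
  have e2 := congrArg (fun w => ⟪n, w⟫) hz4
  simp only [hφ, hT, inner_add_right, inner_smul_right, hJJ, hnn, inner_quarterTurn_self,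
    inner_self_quarterTurn, mul_one, mul_zero, add_zero, zero_add] at e1 e2
  refine ⟨⟨hz1, hz2 (hK.edgeFoot_mem_frontier hz1) (hK.supportPoint_mem_frontier hz0) e1,
    hz3 (hK.edgeFoot_mem_frontier hz1.neg)
      (hK.supportPoint_mem_frontier (neg_ne_zero.2 hz0)) ?_⟩, ?_⟩
  · rw [map_neg, inner_neg_left, inner_neg_left, neg_inj]; exact e2
  rintro z' ⟨-, -, -, -, hz5'⟩ hzz
  have hl := hlip.norm_sub_le hz5' hz5
  refine hl.trans (mul_le_mul_of_nonneg_left ?_ C.2)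
  have m1 := hK.inner_supportPoint_tilt_mono n hzz
  have m3 := hK.inner_supportPoint_neg_tilt_anti n hzz
  have : T z' - T z = (⟪quarterTurn n, supportPoint K (tilt n z')⟫ -
      ⟪quarterTurn n, supportPoint K (tilt n z)⟫) • quarterTurn n +
      (⟪quarterTurn n, supportPoint K (-tilt n z')⟫ -
      ⟪quarterTurn n, supportPoint K (-tilt n z)⟫) • n := by
    rw [hT]; module
  rw [this]
  refine (norm_add_le _ _).trans ?_
  rw [norm_smul, norm_smul, norm_quarterTurn, hn, mul_one, mul_one,
    Real.norm_of_nonneg (by linarith),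
    Real.norm_of_nonpos (by linarith)]
  linarith

end IsOval

section Comparison

variable {K L : Set Plane} (hK : IsOval K) (hL : IsOval L) (hg : covariogram K = covariogram L)
include hK hL hg

/-- Near a parallelogram as in `IsOval.exists_diametral_family`, the diametral vertices of `K`
differ from those of `L` by a fixed translation or by a fixed point reflection. -/
theorem exists_supportPoint_sub_or_add_const {x n : Plane} (hx : IsInnerVector K x) (hn : ‖n‖ = 1)
    (h : edgeFoot K x = supportPoint K n) (h' : edgeFoot K (-x) = supportPoint K (-n))
    (hne : edgeFootDeriv K x ≠ edgeFootDeriv K (-x)) :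
    ∃ b > 0, (∃ w, ∀ z ∈ Icc 0 b, supportPoint K (tilt n z) - supportPoint L (tilt n z) = w) ∨
      ∃ w, ∀ z ∈ Icc 0 b, supportPoint K (tilt n z) + supportPoint L (-tilt n z) = w := by
  obtain ⟨X, C, hC, hXt, s, hs, hfam⟩ := hK.exists_diametral_family hx hn h h' hne
  have hxL := (isInnerVector_congr hK hL hg).1 hx
  have hdich : ∀ z ∈ s, edgeFootDeriv K (X z) = edgeFootDeriv L (X z) ∨
      edgeFootDeriv K (X z) = edgeFootDeriv L (-X z) := by
    intro z hz
    obtain ⟨⟨h1, h2, h3⟩, -⟩ := hfam z hz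
    have hz0 := tilt_ne_zero hn z
    have hc : 0 < ‖tilt n z‖⁻¹ := inv_pos.2 (norm_pos_iff.2 hz0)
    refine edgeFootDeriv_eq_or_eq hK hL hg (n := ‖tilt n z‖⁻¹ • tilt n z) h1
      (norm_smul_inv_norm hz0) ?_ ?_
    · rw [h2, hK.supportPoint_smul hz0 hc]
    · rw [h3, ← smul_neg, hK.supportPoint_smul (neg_ne_zero.2 hz0) hc]
  have hL' : ∀ z ∈ s, edgeFoot L (X z) = supportPoint L (tilt n z) ∧
      edgeFoot L (-X z) = supportPoint L (-tilt n z) := fun z hz =>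
    edgeFoot_eq_supportPoint hK hL hg (hfam z hz).1.1 (tilt_ne_zero hn z) (hfam z hz).1.2.1
      (hfam z hz).1.2.2
  set τ : ℝ → ℝ := fun z => ⟪quarterTurn n, supportPoint K (tilt n z)⟫ -
            ⟪quarterTurn n, supportPoint K (-tilt n z)⟫ with hτ
  have cp := hK.continuous_supportPoint_tilt hn
  have cm := hK.continuous_supportPoint_neg_tilt hn
  have lp := hL.continuous_supportPoint_tilt hn
  have lm := hL.continuous_supportPoint_neg_tilt hn
  have hτc : Continuous τ := (continuous_const.inner cp).sub (continuous_const.inner cm)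
  -- A function of the edge with vanishing derivative along the family is constant on the family.
  have hconst : ∀ (b : ℝ) (G : Plane → Plane) (w : ℝ → Plane), Icc 0 b ⊆ s → Continuous w →
      (∀ z ∈ Icc 0 b, w z = G (X z)) →
      (∀ z ∈ Icc 0 b, HasFDerivAt G (0 : Plane →L[ℝ] Plane) (X z)) →
      ∀ z ∈ Icc 0 b, w z = w 0 := by
    intro b G w hb hw hwG hG
    refine eq_of_forall_eventually_norm_sub_le (τ := τ) hw.continuousOn hτc.continuousOn ?_
    intro z hz ε hε
    have hz' : z ∈ Icc 0 b := ⟨hz.1, hz.2.le⟩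
    have hmem : ∀ᶠ z' in 𝓝[>] z, z' ∈ Icc 0 b ∧ z < z' := by
      filter_upwards [Ioc_mem_nhdsGT hz.2] with z' h1
      exact ⟨⟨hz.1.trans h1.1.le, h1.2⟩, h1.1⟩
    have hlip : ∀ᶠ z' in 𝓝[>] z, ‖X z' - X z‖ ≤ C * (τ z' - τ z) :=
      hmem.mono fun z' h1 => (hfam z (hb hz')).2 z' (hb h1.1) h1.2
    have hXz : Tendsto X (𝓝[>] z) (𝓝 (X z)) := by
      rw [tendsto_iff_norm_sub_tendsto_zero]
      refine squeeze_zero' (Eventually.of_forall fun _ => norm_nonneg _) hlip ?_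
      have : Continuous fun z' => C * (τ z' - τ z) := by fun_prop
      simpa using (this.tendsto z).mono_left nhdsWithin_le_nhds
    have hε' : 0 < ε / (C + 1) := by positivity
    filter_upwards [hXz.eventually ((hG z hz').isLittleO.def hε'), hlip, hmem] with z' h1 h2 h3
    rw [zero_apply, sub_zero, ← hwG z' h3.1, ← hwG z hz'] at h1
    refine h1.trans ((mul_le_mul_of_nonneg_left h2 hε'.le).trans ?_)
    have h4 : 0 ≤ τ z' - τ z := by
      have m1 := hK.inner_supportPoint_tilt_mono n h3.2
      have m3 := hK.inner_supportPoint_neg_tilt_anti n h3.2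
      simp only [hτ]; linarith
    rw [← mul_assoc]
    refine mul_le_mul_of_nonneg_right ?_ h4
    rw [div_mul_eq_mul_div, div_le_iff₀ (by positivity)]
    nlinarith
  have hIcc : ∀ {P : ℝ → Prop}, (∀ᶠ z in 𝓝 (0 : ℝ), P z) → ∃ b > 0, Icc 0 b ⊆ s ∧
      ∀ z ∈ Icc (0 : ℝ) b, P z := by
    intro P hP
    obtain ⟨r, hr, hball⟩ := Metric.eventually_nhds_iff.1 (hP.and hs)
    have hmem : ∀ z ∈ Icc (0 : ℝ) (r / 2), dist z 0 < r := by
      intro z hz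
      rw [Real.dist_eq, sub_zero, abs_of_nonneg hz.1]
      linarith [hz.2]
    exact ⟨r / 2, by positivity, fun z hz => (hball (hmem z hz)).2,
      fun z hz => (hball (hmem z hz)).1⟩
  have kK := hK.continuousAt_edgeFootDeriv hx
  have kL := hL.continuousAt_edgeFootDeriv hxL
  have kL' : ContinuousAt (fun y => edgeFootDeriv L (-y)) x :=
    ContinuousAt.comp (f := fun y : Plane => -y) (hL.continuousAt_edgeFootDeriv hxL.neg)
      continuousAt_neg
  by_cases hcase : edgeFootDeriv K x = edgeFootDeriv L x
  · have hcase' : edgeFootDeriv K x ≠ edgeFootDeriv L (-x) := by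
      intro h0
      have h1 := edgeFootDeriv_add_eq hK hL hg hx
      rw [← hcase, ← h0] at h1
      exact hne (add_left_cancel h1).symm
    have hev : ∀ᶠ z in 𝓝 (0 : ℝ), edgeFootDeriv K (X z) ≠ edgeFootDeriv L (-X z) :=
      (hXt.eventually ((kK.sub kL').eventually_ne (sub_ne_zero.2 hcase'))).mono
        fun _ h0 => sub_ne_zero.1 h0
    obtain ⟨b, hb, hbs, hbP⟩ := hIcc hev
    refine ⟨b, hb, Or.inl ⟨_, hconst b (fun y => edgeFoot K y - edgeFoot L y)
      (fun z => supportPoint K (tilt n z) - supportPoint L (tilt n z)) hbs (cp.sub lp) ?_ ?_⟩⟩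
    · intro z hz
      rw [(hfam z (hbs hz)).1.2.1, (hL' z (hbs hz)).1]
    · intro z hz
      have hi := (hfam z (hbs hz)).1.1
      have h1 := (hK.hasStrictFDerivAt_edgeFoot hi).hasFDerivAt.sub
        (hL.hasStrictFDerivAt_edgeFoot ((isInnerVector_congr hK hL hg).1 hi)).hasFDerivAt
      rwa [(hdich z (hbs hz)).resolve_right (hbP z hz), sub_self] at h1
  · have hev : ∀ᶠ z in 𝓝 (0 : ℝ), edgeFootDeriv K (X z) ≠ edgeFootDeriv L (X z) :=
      (hXt.eventually ((kK.sub kL).eventually_ne (sub_ne_zero.2 hcase))).mono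
        fun _ h0 => sub_ne_zero.1 h0
    obtain ⟨b, hb, hbs, hbP⟩ := hIcc hev
    refine ⟨b, hb, Or.inr ⟨_, hconst b (fun y => edgeFoot K y + edgeFoot L (-y))
      (fun z => supportPoint K (tilt n z) + supportPoint L (-tilt n z)) hbs (cp.add lm) ?_ ?_⟩⟩
    · intro z hz
      rw [(hfam z (hbs hz)).1.2.1, (hL' z (hbs hz)).2]
    · intro z hz
      have hi := (hfam z (hbs hz)).1.1
      have h1 := (hK.hasStrictFDerivAt_edgeFoot hi).hasFDerivAt.add
        (hL.hasStrictFDerivAt_edgeFoot_neg ((isInnerVector_congr hK hL hg).1 hi)).hasFDerivAt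
      rwa [(hdich z (hbs hz)).resolve_left (hbP z hz), add_neg_cancel] at h1

end Comparison

/-! ### Bodies without a transversal diametral parallelogram -/

/-- Twice the midpoint of the diametral chord of `K` with normal direction `u`, the chord that joins
the support points of `u` and `-u`. -/
noncomputable def diametralSum (K : Set Plane) (u : Plane) : Plane :=
  supportPoint K u + supportPoint K (-u)

lemma diametralSum_neg (K : Set Plane) (u : Plane) : diametralSum K (-u) = diametralSum K u := by
  rw [diametralSum, diametralSum, neg_neg, add_comm]

namespace IsOval

variable {K : Set Plane} (hK : IsOval K)
include hK

/-- If the midpoint of one diametral chord lies on the midline of the strip that supports `K` in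
another direction `u`, without being the midpoint of the diametral chord of that direction, then `K`
and its reflection in that point have boundaries that cross transversally: the line supporting
both bodies in the direction `u` touches them at different points, and the boundaries cross between
the two. -/
lemma exists_frontier_of_inner_diametralSum_eq {u u₀ : Plane} (hu : u ≠ 0) (hu₀ : u₀ ≠ 0)
    (h : ⟪u, diametralSum K u⟫ = ⟪u, diametralSum K u₀⟫)
    (hne : diametralSum K u ≠ diametralSum K u₀) :
    ∃ p ∈ frontier K, ∃ q ∈ frontier K, p + q = diametralSum K u₀ ∧
      unitNormal K q ≠ -unitNormal K p := by
  set c := diametralSum K u₀ with hc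
  set m := (1 / 2 : ℝ) • c with hm
  have hmm : m + m = c := by rw [hm]; module
  have hmi : m ∈ interior K := by
    have := hK.midpoint_mem_interior (hK.supportPoint_mem u₀) (hK.supportPoint_mem (-u₀))
      (hK.supportPoint_ne_neg hu₀)
    rw [hm, hc, diametralSum, smul_add]
    exact this
  set P := supportPoint K u with hP
  set Q := supportPoint K (-u) with hQ
  have hPK : P ∈ K := hK.supportPoint_mem u
  have hQK : Q ∈ K := hK.supportPoint_mem (-u)
  have hsum : ⟪u, P⟫ + ⟪u, Q⟫ = ⟪u, c⟫ := by rw [← h, ← inner_add_right]; rfl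
  have hPQ : P + Q ≠ c := hne
  have hcP : c - P ∉ K := by
    intro hmem
    refine hPQ ?_
    have : c - P = Q := hK.eq_supportPoint hmem (neg_ne_zero.2 hu) fun y hy =>
      (hK.inner_le_supportPoint (-u) hy).trans
        (by rw [inner_neg_left, inner_neg_left, inner_sub_right]; linarith)
    rw [← this]; abel
  have hcQ : c - Q ∉ K := by
    intro hmem
    refine hPQ ?_
    have : c - Q = P := hK.eq_supportPoint hmem hu fun y hy =>
      (hK.inner_le_supportPoint u hy).trans (by rw [inner_sub_right]; linarith)
    rw [← this]; abel
  -- The gauge of `K` with respect to `m`.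
  set D : Set Plane := (fun v => m + v) ⁻¹' K with hD
  have hDi : interior D = (fun v => m + v) ⁻¹' interior K :=
    ((Homeomorph.addLeft m).preimage_interior K).symm
  have hDf : frontier D = (fun v => m + v) ⁻¹' frontier K :=
    ((Homeomorph.addLeft m).preimage_frontier K).symm
  have hDconv : Convex ℝ D := hK.convex.translate_preimage_right m
  have hDcl : IsClosed D := hK.isClosed.preimage (by fun_prop)
  have hD0 : D ∈ 𝓝 (0 : Plane) := mem_interior_iff_mem_nhds.1 (by rw [hDi]; simpa using hmi)
  have hle : ∀ v, gauge D v ≤ 1 ↔ m + v ∈ K := fun v => by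
    rw [gauge_le_one_iff_mem_closure hDconv hD0, hDcl.closure_eq]; rfl
  have hgc := continuous_gauge hDconv hD0
  set V : ℝ → Plane := fun l => (1 - l) • P + l • (c - Q) - m with hV
  have hVc : Continuous V := by fun_prop
  have hVu : ∀ l, ⟪u, m + V l⟫ = ⟪u, P⟫ := by
    intro l
    have : m + V l = (1 - l) • P + l • (c - Q) := by rw [hV]; module
    rw [this, inner_add_right, inner_smul_right, inner_smul_right, inner_sub_right, ← hsum]
    ring
  obtain ⟨l, hl, hl0⟩ : ∃ l ∈ Icc (0 : ℝ) 1, gauge D (V l) - gauge D (-V l) = 0 := by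
    have hcont : Continuous fun l => gauge D (V l) - gauge D (-V l) :=
      (hgc.comp hVc).sub (hgc.comp hVc.neg)
    have h0 : gauge D (V 0) - gauge D (-V 0) ≤ 0 := by
      have e1 : m + V 0 = P := by rw [hV]; module
      have e2 : m + -V 0 = c - P := by rw [hV, ← hmm]; module
      have i1 : gauge D (V 0) ≤ 1 := by rw [hle, e1]; exact hPK
      have i2 : ¬ gauge D (-V 0) ≤ 1 := by rw [hle, e2]; exact hcP
      linarith
    have h1 : 0 ≤ gauge D (V 1) - gauge D (-V 1) := by
      have e1 : m + V 1 = c - Q := by rw [hV]; module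
      have e2 : m + -V 1 = Q := by rw [hV, ← hmm]; module
      have i1 : ¬ gauge D (V 1) ≤ 1 := by rw [hle, e1]; exact hcQ
      have i2 : gauge D (-V 1) ≤ 1 := by rw [hle, e2]; exact hQK
      linarith
    exact intermediate_value_Icc zero_le_one hcont.continuousOn ⟨h0, h1⟩
  set r := gauge D (V l) with hr
  have hr1 : 1 ≤ r := by
    by_contra! hlt
    rw [hr, gauge_lt_one_iff_mem_interior hDconv hD0, hDi] at hlt
    have := (hK.isOuterNormal_supportPoint u).inner_lt_of_mem_interior hu hlt
    rw [hVu] at this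
    exact lt_irrefl _ this
  have hr0 : 0 < r := by linarith
  have hrinv : 0 ≤ r⁻¹ := by positivity
  have hp : m + r⁻¹ • V l ∈ frontier K := by
    have : r⁻¹ • V l ∈ frontier D := by
      rw [← gauge_eq_one_iff_mem_frontier hDconv hD0, gauge_smul_of_nonneg hrinv, ← hr, smul_eq_mul,
        inv_mul_cancel₀ hr0.ne']
    rwa [hDf] at this
  have hq : m - r⁻¹ • V l ∈ frontier K := by
    have : r⁻¹ • -V l ∈ frontier D := by
      rw [← gauge_eq_one_iff_mem_frontier hDconv hD0, gauge_smul_of_nonneg hrinv,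
        ← sub_eq_zero.1 hl0,
        smul_eq_mul, inv_mul_cancel₀ hr0.ne']
    rw [hDf] at this
    rw [sub_eq_add_neg, ← smul_neg]
    exact this
  refine ⟨_, hp, _, hq, by rw [← hmm]; abel, fun hn => ?_⟩
  set p := m + r⁻¹ • V l with hp_def
  set q := m - r⁻¹ • V l with hq_def
  have hpq : p + q = c := by rw [← hmm, hp_def, hq_def]; abel
  set ν := unitNormal K p
  have j1 : ⟪ν, P⟫ < ⟪ν, p⟫ := hK.inner_unitNormal_lt hp hPK (by
    intro he
    apply hcP
    rw [he, ← hpq, add_sub_cancel_left]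
    exact hK.frontier_subset hq)
  have j2 : ⟪ν, c - Q⟫ < ⟪ν, p⟫ := by
    have := hK.inner_unitNormal_lt hq hQK (by
      intro he
      apply hcQ
      rw [he, ← hpq, add_sub_cancel_right]
      exact hK.frontier_subset hp)
    rw [hn, inner_neg_left, inner_neg_left] at this
    rw [← hpq, inner_sub_right, inner_add_right]
    linarith
  have j3 := (hK.isOuterNormal_unitNormal hp).inner_lt_of_mem_interior
    (hK.unitNormal_ne_zero hp) hmi
  have j4 : ⟪ν, m + V l⟫ < ⟪ν, p⟫ := by
    have : m + V l = (1 - l) • P + l • (c - Q) := by rw [hV]; module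
    rw [this, inner_add_right, inner_smul_right, inner_smul_right]
    rcases eq_or_lt_of_le hl.1 with h0 | h0
    · rw [← h0]; linarith
    · nlinarith [hl.2]
  change ⟪ν, m⟫ < ⟪ν, p⟫ at j3
  have hin : ⟪ν, p⟫ = ⟪ν, m⟫ + r⁻¹ * ⟪ν, V l⟫ := by
    rw [hp_def, inner_add_right (x := ν), real_inner_smul_right ν (V l)]
  rw [hin, inner_add_right (x := ν)] at j4
  rw [hin] at j3
  have j5 : 0 < ⟪ν, V l⟫ := by
    have : 0 < r⁻¹ := by positivity
    nlinarith
  have j6 : r⁻¹ ≤ 1 := inv_le_one_of_one_le₀ hr1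
  nlinarith

lemma hasFDerivAt_inner_supportPoint {u : Plane} (hu : u ≠ 0) :
    HasFDerivAt (fun v => ⟪v, supportPoint K v⟫) (innerSL ℝ (supportPoint K u)) u := by
  rw [hasFDerivAt_iff_isLittleO, Asymptotics.isLittleO_iff]
  intro c hc
  have h := (hK.continuousAt_supportPoint hu).tendsto.eventually (Metric.ball_mem_nhds _ hc)
  filter_upwards [h] with v hv
  rw [dist_eq_norm] at hv
  have h1 := hK.inner_le_supportPoint v (hK.supportPoint_mem u)
  have h2 := hK.inner_le_supportPoint u (hK.supportPoint_mem v)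
  have h3 := real_inner_le_norm (supportPoint K v - supportPoint K u) (v - u)
  have h4 : ‖supportPoint K v - supportPoint K u‖ * ‖v - u‖ ≤ c * ‖v - u‖ := by gcongr
  rw [innerSL_apply_apply, Real.norm_eq_abs]
  rw [inner_sub_left, inner_sub_right, inner_sub_right] at h3
  rw [inner_sub_right, real_inner_comm v (supportPoint K u), real_inner_comm u (supportPoint K u)]
  rw [real_inner_comm v (supportPoint K v), real_inner_comm u (supportPoint K v),
    real_inner_comm v (supportPoint K u), real_inner_comm u (supportPoint K u)] at h3
  rw [abs_of_nonneg (by linarith)]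
  linarith

lemma tendsto_inner_supportPoint_sub {n : Plane} (hn : n ≠ 0) (v : Plane) :
    Tendsto (fun z : ℝ => ⟪v + z • n, supportPoint K (v + z • n) - supportPoint K n⟫)
      atTop (𝓝 0) := by
  have hdir : Tendsto (fun z : ℝ => z⁻¹ • v + n) atTop (𝓝 n) := by
    have : Tendsto (fun z : ℝ => z⁻¹ • v + n) atTop (𝓝 ((0 : ℝ) • v + n)) :=
      (tendsto_inv_atTop_zero.smul_const v).add_const n
    simpa using this
  have hspt : Tendsto (fun z : ℝ => supportPoint K (v + z • n)) atTop (𝓝 (supportPoint K n)) := by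
    refine ((hK.continuousAt_supportPoint hn).tendsto.comp hdir).congr' ?_
    filter_upwards [hdir.eventually (isOpen_ne.mem_nhds hn), eventually_gt_atTop 0] with z h0 hz
    rw [Function.comp_apply, ← hK.supportPoint_smul h0 hz, smul_add, smul_smul,
      mul_inv_cancel₀ hz.ne', one_smul]
  have hup : Tendsto (fun z : ℝ => ⟪v, supportPoint K (v + z • n) - supportPoint K n⟫) atTop
      (𝓝 0) := by
    have := (tendsto_const_nhds (x := v)).inner (𝕜 := ℝ) (hspt.sub_const (supportPoint K n))
    simpa using this
  refine tendsto_of_tendsto_of_tendsto_of_le_of_le' tendsto_const_nhds hup ?_ ?_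
  · filter_upwards with z
    have := hK.inner_le_supportPoint (v + z • n) (hK.supportPoint_mem n)
    rw [inner_sub_right]; linarith
  · filter_upwards [eventually_ge_atTop 0] with z hz
    have := hK.inner_le_supportPoint n (hK.supportPoint_mem (v + z • n))
    simp only [inner_sub_right, inner_add_left, real_inner_smul_left]
    nlinarith

lemma tendsto_inner_diametralSum_sub {n : Plane} (hn : n ≠ 0) (v : Plane) :
    Tendsto (fun z : ℝ => ⟪v + z • n, diametralSum K (v + z • n) - diametralSum K n⟫)
      atTop (𝓝 0) := by
  have h1 := hK.tendsto_inner_supportPoint_sub hn v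
  have h2 := hK.tendsto_inner_supportPoint_sub (neg_ne_zero.2 hn) (-v)
  have := h1.sub h2
  rw [sub_zero] at this
  refine this.congr fun z => ?_
  have : -v + z • -n = -(v + z • n) := by module
  rw [this, inner_neg_left, diametralSum, diametralSum, sub_neg_eq_add, ← inner_add_right]
  congr 1
  abel

/-- If no parallelogram inscribed in `K` with a diametral diagonal has transversal tangents at its
other two vertices, then all diametral chords have the same midpoint. Otherwise
`u ↦ ⟪u, diametralSum K u - diametralSum K n⟫` has a nonzero extremum on a line of directions,
where the vanishing of its derivative allows the boundary crossing argument. -/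
lemma diametralSum_eq_of_forall {n : Plane} (hn : ‖n‖ = 1)
    (h : ∀ u₀ : Plane, u₀ ≠ 0 → ∀ p ∈ frontier K, ∀ q ∈ frontier K,
      p + q = diametralSum K u₀ → unitNormal K q = -unitNormal K p) (z : ℝ) :
    diametralSum K (quarterTurn n + z • n) = diametralSum K n := by
  have hn0 : n ≠ 0 := by rw [← norm_ne_zero_iff, hn]; exact one_ne_zero
  have hB : ∀ u u₀ : Plane, u ≠ 0 → u₀ ≠ 0 → ⟪u, diametralSum K u⟫ = ⟪u, diametralSum K u₀⟫ →
      diametralSum K u = diametralSum K u₀ := by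
    intro u u₀ hu hu₀ he
    by_contra hne
    obtain ⟨p, hp, q, hq, hpq, hnn⟩ :=
      hK.exists_frontier_of_inner_diametralSum_eq hu hu₀ he hne
    exact hnn (h u₀ hu₀ p hp q hq hpq)
  have hline : ∀ z : ℝ, quarterTurn n + z • n ≠ 0 := by
    intro z h0
    have := congrArg (fun w => ⟪quarterTurn n, w⟫) h0
    simp [inner_add_right, inner_smul_right, hn] at this
  set φ : ℝ → ℝ := fun z => ⟪quarterTurn n + z • n,
    diametralSum K (quarterTurn n + z • n) - diametralSum K n⟫ with hφ
  have hder : ∀ z,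
      HasDerivAt φ ⟪n, diametralSum K (quarterTurn n + z • n) - diametralSum K n⟫ z := by
    intro z
    have hz := hline z
    have l1 : HasDerivAt (fun z : ℝ => quarterTurn n + z • n) n z := by
      simpa using ((hasDerivAt_id z).smul_const n).const_add (quarterTurn n)
    have l2 := l1.neg
    have h1 := (hK.hasFDerivAt_inner_supportPoint hz).comp_hasDerivAt z l1
    have h2 := HasFDerivAt.comp_hasDerivAt (f := fun z : ℝ => -(quarterTurn n + z • n)) z
      (hK.hasFDerivAt_inner_supportPoint (neg_ne_zero.2 hz)) l2
    have h3 : HasDerivAt (fun z : ℝ => ⟪quarterTurn n + z • n, diametralSum K n⟫)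
        ⟪n, diametralSum K n⟫ z := by
      simpa using l1.inner ℝ (hasDerivAt_const z (diametralSum K n))
    have h4 := (h1.sub h2).sub h3
    refine (h4.congr_deriv ?_).congr_of_eventuallyEq (Eventually.of_forall fun y => ?_)
    · simp only [innerSL_apply_apply, inner_neg_right, diametralSum, inner_sub_right,
        inner_add_right]
      rw [real_inner_comm n, real_inner_comm n (supportPoint K (-(quarterTurn n + z • n)))]
      ring
    · simp only [hφ, Pi.sub_apply, Function.comp_apply, diametralSum, inner_sub_right,
        inner_add_right, inner_neg_left]
      ring
  have hcont : Continuous φ := continuous_iff_continuousAt.2 fun z => (hder z).continuousAt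
  have hlim : Tendsto φ (cocompact ℝ) (𝓝 0) := by
    rw [cocompact_eq_atBot_atTop]
    refine Tendsto.sup ?_ (hK.tendsto_inner_diametralSum_sub hn0 _)
    have h1 := (hK.tendsto_inner_diametralSum_sub (neg_ne_zero.2 hn0) (quarterTurn n)).comp
      tendsto_neg_atBot_atTop
    refine h1.congr fun y => ?_
    simp only [hφ, Function.comp_apply, neg_smul_neg, diametralSum_neg]
  have hcrit : ∀ z, ⟪n, diametralSum K (quarterTurn n + z • n) - diametralSum K n⟫ = 0 →
      φ z = 0 := by
    intro z hz
    rw [inner_sub_right, sub_eq_zero] at hz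
    rw [hφ]
    dsimp only
    rw [hB n _ hn0 (hline z) hz.symm, sub_self, inner_zero_right]
  have hzero : ∀ z, φ z = 0 := by
    intro z
    rcases lt_trichotomy (φ z) 0 with hz | hz | hz
    · obtain ⟨y, hy⟩ := hcont.exists_forall_le' z
        ((hlim.eventually (lt_mem_nhds hz)).mono fun _ h => h.le)
      have h1 : IsLocalMin φ y := Eventually.of_forall hy
      have h2 := hcrit y (h1.hasDerivAt_eq_zero (hder y))
      have h3 := hy z
      linarith
    · exact hz
    · obtain ⟨y, hy⟩ := hcont.exists_forall_ge' z
        ((hlim.eventually (gt_mem_nhds hz)).mono fun _ h => h.le)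
      have h1 : IsLocalMax φ y := Eventually.of_forall hy
      have h2 := hcrit y (h1.hasDerivAt_eq_zero (hder y))
      have h3 := hy z
      linarith
  refine hB _ _ (hline z) hn0 ?_
  have := hzero z
  rw [hφ] at this
  dsimp only at this
  rwa [inner_sub_right, sub_eq_zero] at this

end IsOval

/-! ### Agreement of two ovals with the same covariogram along an arc -/

namespace IsOval

variable {K : Set Plane} (hK : IsOval K)
include hK

lemma unitNormal_supportPoint_of_norm_eq_one {n : Plane} (hn : ‖n‖ = 1) :
    unitNormal K (supportPoint K n) = n := by
  have hn0 : n ≠ 0 := by rw [← norm_ne_zero_iff, hn]; exact one_ne_zero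
  rw [hK.unitNormal_supportPoint hn0, hn, inv_one, one_smul]

lemma isInnerVector_sub {p q r s : Plane} (hp : p ∈ K) (hq : q ∈ K) (hr : r ∈ K) (hs : s ∈ K)
    (h : p + q = r + s) (hpr : p ≠ r) (hqr : q ≠ r) : IsInnerVector K (p - r) := by
  have hps : p ≠ s := fun he => hqr (by rw [he, add_comm r s] at h; exact add_left_cancel h)
  refine ⟨sub_ne_zero.2 hpr, _, hK.midpoint_mem_interior hq hr hqr, ?_⟩
  convert hK.midpoint_mem_interior hp hs hps using 1
  have : s = p + q - r := by rw [h]; abel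
  rw [this]
  module

/-- Only one orientation of the vertices `r`, `p`, `q` allows `r` not to be the foot of the edge
`p - r` of an inscribed parallelogram. -/
lemma edgeFoot_sub_eq_or_inner_neg {p q r s : Plane} (hp : p ∈ frontier K) (hq : q ∈ frontier K)
    (hr : r ∈ frontier K) (hs : s ∈ frontier K) (h : p + q = r + s) (hpr : p ≠ r) (hqr : q ≠ r) :
    edgeFoot K (p - r) = r ∨ ⟪quarterTurn (p - r), q - r⟫ < 0 := by
  have hx := hK.isInnerVector_sub (hK.frontier_subset hp) (hK.frontier_subset hq)
    (hK.frontier_subset hr) (hK.frontier_subset hs) h hpr hqr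
  rcases hK.eq_edgeFoot_or_eq hx hr (by simpa using hp) with h1 | h1
  · exact Or.inl h1.symm
  · right
    have h2 : edgeFoot K (-(p - r)) = p := by
      rw [← sub_add_cancel (edgeFoot K _) (p - r), ← h1]; abel
    have h3 : q + (p - r) = s := by rw [← add_sub_assoc, add_comm q, h]; abel
    rcases hK.eq_edgeFoot_or_eq hx hq (by rwa [h3]) with h4 | h4
    · have h5 := hK.inner_edgeFoot_lt_neg hx
      rw [h2, ← h4] at h5
      have h6 := inner_quarterTurn_self (p - r)
      rw [inner_sub_right] at h6 ⊢
      linarith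
    · exact absurd (h4.trans h1.symm) hqr

/-- Suppose that the support points of `n` and `-n` are opposite vertices of an inscribed
parallelogram, and that the tangents at the other vertices `p` and `q` are not parallel. Then the
derivatives of the first two vertices differ; `hf` says that `p` and `q` are labelled in the order
used by `edgeFoot`. -/
lemma edgeFootDeriv_ne_of_edgeFoot_eq {n p q : Plane} (hn : ‖n‖ = 1) (hp : p ∈ frontier K)
    (hq : q ∈ frontier K) (h : p + q = diametralSum K n) (hpn : p ≠ supportPoint K n)
    (hqn : q ≠ supportPoint K n) (hne : unitNormal K q ≠ -unitNormal K p)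
    (hf : edgeFoot K (p - supportPoint K n) = supportPoint K n) :
    ∃ x, IsInnerVector K x ∧ edgeFoot K x = supportPoint K n ∧
      edgeFoot K (-x) = supportPoint K (-n) ∧ edgeFootDeriv K x ≠ edgeFootDeriv K (-x) := by
  have hn0 : n ≠ 0 := by rw [← norm_ne_zero_iff, hn]; exact one_ne_zero
  have hr := hK.supportPoint_mem_frontier hn0
  have hs := hK.supportPoint_mem_frontier (neg_ne_zero.2 hn0)
  rw [diametralSum] at h
  set r := supportPoint K n with hr_def
  set s := supportPoint K (-n) with hs_def
  set x := p - r with hx_def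
  have hx : IsInnerVector K x := hK.isInnerVector_sub (hK.frontier_subset hp)
    (hK.frontier_subset hq) (hK.frontier_subset hr) (hK.frontier_subset hs) h hpn hqn
  have hsx : s + -x = q := by
    have : q = r + s - p := by rw [← h]; abel
    rw [this, hx_def]; abel
  have hrx : r + x = p := by rw [hx_def]; abel
  have hf' : edgeFoot K (-x) = s := by
    rcases hK.eq_edgeFoot_or_eq hx.neg hs (by rwa [hsx]) with h1 | h1
    · exact h1.symm
    · rw [neg_neg, hf, sub_neg_eq_add, hrx] at h1
      rw [h1, add_comm r p] at h
      exact absurd (add_left_cancel h) hqn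
  refine ⟨x, hx, hf, hf', fun he => ?_⟩
  have i2 := hK.inner_unitNormal_ne_zero hx
  have i4 := hK.inner_unitNormal_ne_zero hx.neg
  have hnr : unitNormal K r = n := hK.unitNormal_supportPoint_of_norm_eq_one hn
  have hns : unitNormal K s = -n :=
    hK.unitNormal_supportPoint_of_norm_eq_one (by rw [norm_neg, hn])
  rw [hf, hrx, hnr] at i2
  rw [hf', hsx, hns, map_neg, inner_neg_right, neg_ne_zero] at i4
  rw [real_inner_comm] at i2 i4
  rw [edgeFootDeriv, edgeFootDeriv, hf, hf', hrx, hsx, hnr, hns, footSlide_neg_left,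
    footSlide_eq_iff_coslope hn i2 i4, coslope, coslope, div_eq_div_iff i2 i4] at he
  have h0 : ⟪quarterTurn (unitNormal K p), unitNormal K q⟫ = 0 := by
    rw [inner_eq_frame hn, inner_quarterTurn_quarterTurn, real_inner_comm,
      inner_quarterTurn_comm]
    linarith
  rcases eq_or_eq_neg_of_inner_quarterTurn_eq_zero (hK.norm_unitNormal hp) (hK.norm_unitNormal hq)
    h0 with h1 | h1
  · have hqp : q = p := by
      rw [← hK.supportPoint_unitNormal hq, h1, hK.supportPoint_unitNormal hp]
    have hm := hK.midpoint_mem_interior (hK.supportPoint_mem n) (hK.supportPoint_mem (-n))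
      (hK.supportPoint_ne_neg hn0)
    rw [← smul_add, ← hr_def, ← hs_def, ← h, hqp, ← two_smul ℝ p, smul_smul] at hm
    rw [hK.isClosed.frontier_eq] at hp
    exact hp.2 (by simpa using hm)
  · exact hne h1

/-- `IsOval.edgeFootDeriv_ne_of_edgeFoot_eq` applies to one of the two labellings of the vertices
off the diametral diagonal. -/
lemma exists_edgeFootDeriv_ne {u p q : Plane} (hu : u ≠ 0) (hp : p ∈ frontier K)
    (hq : q ∈ frontier K) (h : p + q = diametralSum K u)
    (hne : unitNormal K q ≠ -unitNormal K p) :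
    ∃ n x, ‖n‖ = 1 ∧ IsInnerVector K x ∧ edgeFoot K x = supportPoint K n ∧
      edgeFoot K (-x) = supportPoint K (-n) ∧ edgeFootDeriv K x ≠ edgeFootDeriv K (-x) := by
  set n : Plane := ‖u‖⁻¹ • u with hn_def
  have hn : ‖n‖ = 1 := norm_smul_inv_norm hu
  have hn0 : n ≠ 0 := by rw [← norm_ne_zero_iff, hn]; exact one_ne_zero
  have hc : 0 < ‖u‖⁻¹ := inv_pos.2 (norm_pos_iff.2 hu)
  have hd : diametralSum K u = diametralSum K n := by
    rw [diametralSum, diametralSum, hn_def, ← smul_neg, hK.supportPoint_smul hu hc,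
      hK.supportPoint_smul (neg_ne_zero.2 hu) hc]
  rw [hd] at h
  have hnr := hK.unitNormal_supportPoint_of_norm_eq_one hn
  have hns := hK.unitNormal_supportPoint_of_norm_eq_one (n := -n) (by rw [norm_neg, hn])
  have hpn : p ≠ supportPoint K n := by
    intro he
    rw [he, diametralSum] at h
    exact hne (by rw [he, add_left_cancel h, hnr, hns])
  have hqn : q ≠ supportPoint K n := by
    intro he
    rw [he, diametralSum, add_comm] at h
    exact hne (by rw [he, add_left_cancel h, hnr, hns, neg_neg])
  have hr := hK.supportPoint_mem_frontier hn0
  have hs := hK.supportPoint_mem_frontier (neg_ne_zero.2 hn0)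
  have h' : q + p = diametralSum K n := by rw [add_comm, h]
  rcases hK.edgeFoot_sub_eq_or_inner_neg hp hq hr hs h hpn hqn with h1 | h1
  · obtain ⟨x, hx⟩ := hK.edgeFootDeriv_ne_of_edgeFoot_eq hn hp hq h hpn hqn hne h1
    exact ⟨n, x, hn, hx⟩
  rcases hK.edgeFoot_sub_eq_or_inner_neg hq hp hr hs h' hqn hpn with h2 | h2
  · have hne' : unitNormal K p ≠ -unitNormal K q := fun he => hne (by rw [he, neg_neg])
    obtain ⟨x, hx⟩ := hK.edgeFootDeriv_ne_of_edgeFoot_eq hn hq hp h' hqn hpn hne' h2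
    exact ⟨n, x, hn, hx⟩
  · rw [inner_quarterTurn_comm] at h2
    linarith

end IsOval

lemma tilt_neg (n : Plane) (z : ℝ) : tilt (-n) z = -tilt n z := by
  rw [tilt, tilt, map_neg, smul_neg, neg_add]

/-- Two ovals with the same covariogram have the same support points, up to a translation or a point
reflection, in an interval of directions. -/
theorem exists_supportPoint_sub_or_add_const_of_covariogram_eq {K L : Set Plane} (hK : IsOval K)
    (hL : IsOval L) (hg : covariogram K = covariogram L) :
    ∃ n : Plane, ‖n‖ = 1 ∧ ∃ b > 0,
      (∃ w, ∀ z ∈ Icc 0 b, supportPoint K (tilt n z) - supportPoint L (tilt n z) = w) ∨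
      ∃ w, ∀ z ∈ Icc 0 b, supportPoint K (tilt n z) + supportPoint L (-tilt n z) = w := by
  by_cases hKt : ∀ u : Plane, u ≠ 0 → ∀ p ∈ frontier K, ∀ q ∈ frontier K,
      p + q = diametralSum K u → unitNormal K q = -unitNormal K p
  swap
  · push Not at hKt
    obtain ⟨u, hu, p, hp, q, hq, h, hne⟩ := hKt
    obtain ⟨n, x, hn, hx, h1, h2, h3⟩ := hK.exists_edgeFootDeriv_ne hu hp hq h hne
    exact ⟨n, hn, exists_supportPoint_sub_or_add_const hK hL hg hx hn h1 h2 h3⟩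
  by_cases hLt : ∀ u : Plane, u ≠ 0 → ∀ p ∈ frontier L, ∀ q ∈ frontier L,
      p + q = diametralSum L u → unitNormal L q = -unitNormal L p
  swap
  · push Not at hLt
    obtain ⟨u, hu, p, hp, q, hq, h, hne⟩ := hLt
    obtain ⟨n, x, hn, hx, h1, h2, h3⟩ := hL.exists_edgeFootDeriv_ne hu hp hq h hne
    obtain ⟨b, hb, ⟨w, hw⟩ | ⟨w, hw⟩⟩ :=
      exists_supportPoint_sub_or_add_const hL hK hg.symm hx hn h1 h2 h3
    · exact ⟨n, hn, b, hb, Or.inl ⟨-w, fun z hz => by rw [← hw z hz, neg_sub]⟩⟩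
    · refine ⟨-n, by rw [norm_neg, hn], b, hb, Or.inr ⟨w, fun z hz => ?_⟩⟩
      rw [← hw z hz, tilt_neg, neg_neg, add_comm]
  -- Now the diametral chords of each body have a common midpoint, and those of `K` are translates
  -- of those of `L`.
  obtain ⟨n, hn⟩ : ∃ n : Plane, ‖n‖ = 1 := ⟨EuclideanSpace.single 0 1, by simp⟩
  have hm : ‖quarterTurn n‖ = 1 := by rw [norm_quarterTurn, hn]
  refine ⟨quarterTurn n, hm, 1, one_pos,
    Or.inl ⟨(1 / 2 : ℝ) • (diametralSum K n - diametralSum L n), fun z _ => ?_⟩⟩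
  have ht : quarterTurn n + (-z) • n = tilt (quarterTurn n) z := by
    rw [tilt, quarterTurn_quarterTurn, smul_neg, neg_smul]
  have h1 := hK.diametralSum_eq_of_forall hn hKt (-z)
  have h2 := hL.diametralSum_eq_of_forall hn hLt (-z)
  have h3 := supportPoint_sub_supportPoint_neg_eq hK hL hg (tilt_ne_zero hm z)
  rw [ht] at h1 h2
  rw [← h1, ← h2, diametralSum, diametralSum]
  have h4 : supportPoint K (-tilt (quarterTurn n) z) = supportPoint K (tilt (quarterTurn n) z) -
      (supportPoint L (tilt (quarterTurn n) z) - supportPoint L (-tilt (quarterTurn n) z)) := by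
    rw [← h3]; abel
  rw [h4]
  module

/-! ### From supporting lines to normals, and the arc -/

lemma IsC1Regular.isOval {K : ConvexBody Plane} (hreg : IsC1Regular (K : Set Plane))
    (hint : (interior (K : Set Plane)).Nonempty) (hstrict : StrictConvex ℝ (K : Set Plane)) :
    IsOval (K : Set Plane) where
  isCompact := K.isCompact
  strictConvex := hstrict
  nonempty_interior := hint
  normal_unique := by
    intro p hp u v hu hv hpu hpv
    have hu0 : u ≠ 0 := by rw [← norm_ne_zero_iff, hu]; exact one_ne_zero
    have hv0 : v ≠ 0 := by rw [← norm_ne_zero_iff, hv]; exact one_ne_zero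
    have hH := (hreg p hp).unique ⟨u, hu0, rfl, hpu⟩ ⟨v, hv0, rfl, hpv⟩
    have hmem : p + quarterTurn u ∈ {x : Plane | ⟪u, x⟫ = ⟪u, p⟫} := by
      simp [inner_add_right]
    rw [hH] at hmem
    have h0 : ⟪quarterTurn u, v⟫ = 0 := by
      simpa [inner_add_right, real_inner_comm] using hmem
    rcases eq_or_eq_neg_of_inner_quarterTurn_eq_zero hu hv h0 with h | h
    · exact h.symm
    · obtain ⟨z, hz⟩ := hint
      have h1 := hpu.inner_lt_of_mem_interior hu0 hz
      have h2 := hpv.inner_lt_of_mem_interior hv0 hz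
      rw [h, inner_neg_left, inner_neg_left] at h2
      linarith

lemma IsOval.isNondegenerateBoundaryArc {L : Set Plane} (hL : IsOval L) {n : Plane}
    (hn : ‖n‖ = 1) {b : ℝ} (hb : 0 < b) :
    IsNondegenerateBoundaryArc L
      (range fun s : unitInterval => supportPoint L (tilt n (b * (s : ℝ)))) := by
  refine ⟨?_, _, ?_, ?_, rfl⟩
  · rintro _ ⟨s, rfl⟩
    exact hL.supportPoint_mem_frontier (tilt_ne_zero hn _)
  · exact (hL.continuous_supportPoint_tilt hn).comp (by fun_prop)
  · intro s t hst
    have h0 := tilt_ne_zero hn (b * (s : ℝ))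
    have h1 := congrArg (unitNormal L) hst
    dsimp only at h1
    rw [hL.unitNormal_supportPoint h0, hL.unitNormal_supportPoint (tilt_ne_zero hn _)] at h1
    have h2 := congrArg (fun v => ⟪n, v⟫) h1
    have h3 := congrArg (fun v => ⟪quarterTurn n, v⟫) h1
    simp only [inner_smul_right, inner_tilt hn, inner_quarterTurn_tilt hn, mul_one] at h2 h3
    rw [← h2] at h3
    have h4 := mul_left_cancel₀ (inv_ne_zero (norm_ne_zero_iff.2 h0)) h3
    exact Subtype.ext (mul_left_cancel₀ hb.ne' h4)

theorem proposition2 (K L : ConvexBody (EuclideanSpace ℝ (Fin 2)))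
    (hKint : (interior (K : Set (EuclideanSpace ℝ (Fin 2)))).Nonempty)
    (hLint : (interior (L : Set (EuclideanSpace ℝ (Fin 2)))).Nonempty)
    (hKstrict : StrictConvex ℝ (K : Set (EuclideanSpace ℝ (Fin 2))))
    (hLstrict : StrictConvex ℝ (L : Set (EuclideanSpace ℝ (Fin 2))))
    (hKreg : IsC1Regular (K : Set (EuclideanSpace ℝ (Fin 2))))
    (hLreg : IsC1Regular (L : Set (EuclideanSpace ℝ (Fin 2))))
    (hcov : covariogram (K : Set (EuclideanSpace ℝ (Fin 2))) =
      covariogram (L : Set (EuclideanSpace ℝ (Fin 2)))) :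
    ∃ A : Set (EuclideanSpace ℝ (Fin 2)),
      IsNondegenerateBoundaryArc (L : Set (EuclideanSpace ℝ (Fin 2))) A ∧
      ((∃ v : EuclideanSpace ℝ (Fin 2),
          v +ᵥ A ⊆ frontier (K : Set (EuclideanSpace ℝ (Fin 2)))) ∨
        (∃ c : EuclideanSpace ℝ (Fin 2),
          Equiv.pointReflection c '' A ⊆ frontier (K : Set (EuclideanSpace ℝ (Fin 2))))) := by
  have hK := hKreg.isOval hKint hKstrict
  have hL := hLreg.isOval hLint hLstrict
  obtain ⟨n, hn, b, hb, h⟩ := exists_supportPoint_sub_or_add_const_of_covariogram_eq hK hL hcov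
  have hIcc : ∀ s : unitInterval, b * (s : ℝ) ∈ Icc 0 b := fun s =>
    ⟨mul_nonneg hb.le s.2.1, mul_le_of_le_one_right hb.le s.2.2⟩
  rcases h with ⟨w, hw⟩ | ⟨w, hw⟩
  · refine ⟨_, hL.isNondegenerateBoundaryArc hn hb, Or.inl ⟨w, ?_⟩⟩
    rintro _ ⟨_, ⟨s, rfl⟩, rfl⟩
    have : w +ᵥ supportPoint L (tilt n (b * (s : ℝ))) = supportPoint K (tilt n (b * (s : ℝ))) := by
      rw [← hw _ (hIcc s), vadd_eq_add, sub_add_cancel]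
    dsimp only
    rw [this]
    exact hK.supportPoint_mem_frontier (tilt_ne_zero hn _)
  · refine ⟨_, hL.isNondegenerateBoundaryArc (n := -n) (by rw [norm_neg, hn]) hb,
      Or.inr ⟨(1 / 2 : ℝ) • w, ?_⟩⟩
    rintro _ ⟨_, ⟨s, rfl⟩, rfl⟩
    have : Equiv.pointReflection ((1 / 2 : ℝ) • w) (supportPoint L (tilt (-n) (b * (s : ℝ)))) =
        supportPoint K (tilt n (b * (s : ℝ))) := by
      rw [← hw _ (hIcc s), tilt_neg, Equiv.pointReflection_apply, vsub_eq_sub, vadd_eq_add]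
      module
    dsimp only
    rw [this]
    exact hK.supportPoint_mem_frontier (tilt_ne_zero hn _)
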